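/- Let $S_{1,1}$ be the once-punctured torus, let $X\in\mathcal T(S_{1,1})$ be a point of its Teichmüller space, i.e. a marked complete hyperbolic structure of finite area on $S_{1,1}$, and let $\gamma$ be a simple closed geodesic of $X$. Write $\ell_\gamma(X)$ for the hyperbolic length of $\gamma$ in $X$, $\ell_{\mathrm{sys}}(Y)$ for the length of the shortest closed geodesic of a hyperbolic structure $Y$, and, for $t\in\mathbb R$, $E_t(X,\gamma)$ for the hyperbolic structure obtained from $X$ by the earthquake (Fenchel–Nielsen twist) along $\gamma$ by hyperbolic distance $t$, that is, by cutting $X$ along $\gamma$ and regluing the two sides after a slide by distance $t$. For $L>0$ put $$R(L)=2\log\left(\frac{e^{L/2}+1}{e^{L/2}-1}\right).$$ Then $$\liminf_{t\to\infty}\ell_{\mathrm{sys}}\bigl(E_t(X,\gamma)\bigr)=\min\bigl\{\ell_\gamma(X),\,R(\ell_\gamma(X))\bigr\}.$$ This holds for either of the two directions of twisting. -/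

import Mathlib

open scoped MatrixGroups UpperHalfPlane

namespace PuncturedTorus

/-- The fundamental group of the once-punctured torus `S_{1,1}`: the free group on two simple loops
that intersect exactly once. -/
abbrev Pi1 : Type := FreeGroup (Fin 2)

/-- The first of the two fixed generators. -/
def genA : Pi1 := FreeGroup.of 0

/-- The second of the two fixed generators. -/
def genB : Pi1 := FreeGroup.of 1

/-- `ρ` is the holonomy of a marked complete hyperbolic structure of finite area on `S_{1,1}`, that
is, a point of the Teichmüller space `T(S_{1,1})`: the fundamental group acts freely and properly
discontinuously by orientation preserving isometries of the hyperbolic plane, and the loop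
`[a, b]` around the puncture is parabolic (the puncture is a cusp).
A point of the Teichmüller space is such a `ρ` up to conjugation (and up to the choice of a lift
from `PSL(2, ℝ)` to `SL(2, ℝ)`); all quantities below are invariant under these changes. -/
structure IsTeichmullerPoint (ρ : Pi1 →* SL(2, ℝ)) : Prop where
  free : ∀ g : Pi1, g ≠ 1 → ∀ z : ℍ, ρ g • z ≠ z
  properlyDiscontinuous : ∀ K : Set ℍ, IsCompact K →
    {g : Pi1 | ((fun z : ℍ => ρ g • z) '' K ∩ K).Nonempty}.Finite
  cusp : (ρ (genA * genB * genA⁻¹ * genB⁻¹) : Matrix (Fin 2) (Fin 2) ℝ).IsParabolic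

/-- The translation length of an isometry of the hyperbolic plane. -/
noncomputable def translationLength (A : SL(2, ℝ)) : ℝ := ⨅ z : ℍ, dist z (A • z)

/-- The length `ℓ_g(X)` of the closed geodesic in the free homotopy class of `g`. -/
noncomputable def length (ρ : Pi1 →* SL(2, ℝ)) (g : Pi1) : ℝ := translationLength (ρ g)

/-- The systole length: the length of the shortest closed geodesic. The closed geodesics are the
quotients of the axes of the hyperbolic elements. -/
noncomputable def systole (ρ : Pi1 →* SL(2, ℝ)) : ℝ :=
  sInf {l : ℝ | ∃ g : Pi1, (ρ g : Matrix (Fin 2) (Fin 2) ℝ).IsHyperbolic ∧ l = length ρ g}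

/-- For hyperbolic `A`, the matrix `cosh (t/2) + sinh (t/2) N`, where
`N = sign (tr A) (A - tr A / 2) / √((tr A)² / 4 - 1)` satisfies `N² = 1`, `tr N = 0`. -/
noncomputable def axisTranslationMatrix (A : SL(2, ℝ)) (t : ℝ) : Matrix (Fin 2) (Fin 2) ℝ :=
  Real.cosh (t / 2) • (1 : Matrix (Fin 2) (Fin 2) ℝ) +
    (Real.sinh (t / 2) * (SignType.sign (A : Matrix (Fin 2) (Fin 2) ℝ).trace : ℝ) /
      √((A : Matrix (Fin 2) (Fin 2) ℝ).trace ^ 2 / 4 - 1)) •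
    ((A : Matrix (Fin 2) (Fin 2) ℝ) -
      ((A : Matrix (Fin 2) (Fin 2) ℝ).trace / 2) • (1 : Matrix (Fin 2) (Fin 2) ℝ))

theorem det_axisTranslationMatrix (A : SL(2, ℝ))
    (hA : (A : Matrix (Fin 2) (Fin 2) ℝ).IsHyperbolic) (t : ℝ) :
    (axisTranslationMatrix A t).det = 1 := by
  have hdet : (A : Matrix (Fin 2) (Fin 2) ℝ).det = 1 := A.2
  rw [Matrix.IsHyperbolic, Matrix.discr_fin_two, hdet] at hA
  unfold axisTranslationMatrix
  set M := (A : Matrix (Fin 2) (Fin 2) ℝ) with hM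
  have htr : M.trace ≠ 0 := by
    intro h
    rw [h] at hA
    norm_num at hA
  have hpos : 0 < M.trace ^ 2 / 4 - 1 := by linarith
  set r := √(M.trace ^ 2 / 4 - 1) with hr
  have hr0 : r ≠ 0 := (Real.sqrt_pos.mpr hpos).ne'
  have hr2 : r ^ 2 = M.trace ^ 2 / 4 - 1 := Real.sq_sqrt hpos.le
  have hs : ((SignType.sign M.trace : SignType) : ℝ) ^ 2 = 1 := by
    rcases lt_or_gt_of_ne htr with h | h
    · simp [sign_neg h]
    · simp [sign_pos h]
  have hc := Real.cosh_sq (t / 2)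
  set k := Real.sinh (t / 2) * ((SignType.sign M.trace : SignType) : ℝ) / r with hk
  have hk2 : k ^ 2 * r ^ 2 = Real.sinh (t / 2) ^ 2 := by
    rw [hk, div_pow, mul_pow, hs]
    field_simp
  rw [hr2] at hk2
  rw [Matrix.det_fin_two] at hdet ⊢
  rw [Matrix.trace_fin_two] at *
  simp
  linear_combination hc - hk2 - k ^ 2 * hdet * (-1)

open Classical in
/-- For hyperbolic `A`, the isometry that translates by the signed distance `t` along the axis of
`A`, in the direction in which `A` translates (junk value `1` if `A` is not hyperbolic). -/
noncomputable def axisTranslation (A : SL(2, ℝ)) (t : ℝ) : SL(2, ℝ) :=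
  if hA : (A : Matrix (Fin 2) (Fin 2) ℝ).IsHyperbolic then
    ⟨axisTranslationMatrix A t, det_axisTranslationMatrix A hA t⟩
  else 1

/-- `γ` is (the class of) an oriented simple closed geodesic: a non-peripheral simple closed curve on
`S_{1,1}`, that is, the image of the first generator under a mapping class. The mapping classes,
orientation reversing ones included, are the automorphisms of the fundamental group, so these `γ`
are the elements that belong to a pair of free generators. -/
def IsSimpleClosedGeodesic (γ : Pi1) : Prop := ∃ θ : Pi1 ≃* Pi1, θ genA = γ

/-- The twist `E_t(X, γ)` by distance `t` along the simple closed geodesic `γ = θ a`, where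
`δ = θ b` crosses `γ` exactly once. Cutting the surface along `γ` presents its fundamental group as
an HNN extension with stable letter `δ`; regluing after a slide by the distance `t` along `γ` keeps
the holonomy of `γ` and composes the holonomy of `δ` with the translation by `t` along the axis
of `γ`. The result does not change if `δ` is replaced by `γ ^ m * δ * γ ^ n`; the two
orientations of `δ` relative to `γ` give the twists to the left and to the right. -/
noncomputable def earthquake (ρ : Pi1 →* SL(2, ℝ)) (θ : Pi1 ≃* Pi1) (t : ℝ) : Pi1 →* SL(2, ℝ) :=
  (FreeGroup.lift ![ρ (θ genA), ρ (θ genB) * axisTranslation (ρ (θ genA)) t]).comp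
    θ.symm.toMonoidHom

/-- `R(L)`, the injectivity radius associated to a simple closed geodesic of length `L`. -/
noncomputable def injRadius (L : ℝ) : ℝ :=
  2 * Real.log ((Real.exp (L / 2) + 1) / (Real.exp (L / 2) - 1))

end PuncturedTorus

/-! Everything is read off from traces: a hyperbolic `A` translates by `2 arsinh (√(tr² A - 4) /
2)`. For a basis `a, b` of the free group with `γ = a`, let `x, y, z` be the traces of `a`, `b`,
`ab`. The cusp forces the commutator to have trace `-2`, that is `x² + y² + z² = xyz`, for every
basis (`trace_commutator_automorphism`) and every twist parameter. With `L` the length of `a`, the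
number `R(L)` satisfies `sinh (L/2) sinh (R/2) = 1`, so it is the length belonging to the squared
trace `4x² / (x² - 4)`. This is the least squared trace that `b` can attain under twisting, reached
when `b` crosses `a` orthogonally.

Upper bound. The curve `a` keeps its length. After composing `b` with the translation by `t`, its
trace is a combination of `cosh (t/2)` and `sinh (t/2)`, and at some `u` its square equals `4x² /
(x² - 4)`. Twisting by `L` is a Dehn twist, so at time `u + kL` the curve `b a⁻ᵏ` has this trace,
and `R(L)` bounds the systole for arbitrarily large `t` (`exists_systole_earthquake_le`).

Lower bound, for every `t` (`trace_sq_lower_bound`). In a cyclic word either two successive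
`b`-letters have equal sign, or the signs alternate. In the first case the word is, up to
conjugation, inversion and a power of `a` on the right, a word `h` that begins and ends with `b`.
Ping-pong gives `tr [a, h] ≤ -2`, and completing the square in the trace identity for commutators
yields `tr² h ≥ 4x² / (x² - 4)`. In the second case the element is conjugate into the group `⟨a, b a
b⁻¹⟩` of the pair of pants cut out by `a`, where another ping-pong gives `|tr| = 2` or `|tr| ≥ |x|`.
Both games are played with explicit matrices; `trace_eq_of_trace_eq` transfers the result, since
traces of words depend only on three traces. -/

namespace PuncturedTorus

/-! ### Trace identities for pairs in `SL(2)`. -/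

section TraceIdentities

variable {R : Type*} [CommRing R]

theorem coe_inv_eq (g : SL(2, R)) : (g⁻¹).1 = g.1.trace • (1 : Matrix (Fin 2) (Fin 2) R) - g.1 := by
  rw [Matrix.SpecialLinearGroup.coe_inv, Matrix.adjugate_fin_two]
  ext i j
  fin_cases i <;> fin_cases j <;> simp [Matrix.trace_fin_two]

theorem mul_self_eq (g : SL(2, R)) :
    g.1 * g.1 = g.1.trace • g.1 - (1 : Matrix (Fin 2) (Fin 2) R) := by
  have h : g.1 * (g⁻¹).1 = 1 := by
    rw [← Matrix.SpecialLinearGroup.coe_mul, mul_inv_cancel, Matrix.SpecialLinearGroup.coe_one]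
  rw [coe_inv_eq, mul_sub, mul_smul_comm, mul_one] at h
  rw [← h]; abel

theorem mul_add_mul_swap (A B : Matrix (Fin 2) (Fin 2) R) :
    B * A = -(A * B) + A.trace • B + B.trace • A +
      ((A * B).trace - A.trace * B.trace) • (1 : Matrix (Fin 2) (Fin 2) R) := by
  ext i j
  fin_cases i <;> fin_cases j <;> simp [Matrix.mul_apply, Matrix.trace_fin_two] <;> ring

theorem mul_mul_self_eq (A B : SL(2, R)) :
    B.1 * (A.1 * B.1) = A.1 + (A.1 * B.1).trace • B.1
      - A.1.trace • (1 : Matrix (Fin 2) (Fin 2) R) := by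
  rw [← mul_assoc, mul_add_mul_swap A.1 B.1]
  simp only [add_mul, neg_mul, smul_mul_assoc, one_mul, mul_assoc, mul_self_eq B, mul_sub,
    mul_smul_comm, mul_one]
  module

/-- The linear combination `c₀ + c₁ A + c₂ B + c₃ A B`. -/
def wordCombination (A B : SL(2, R)) (c : Fin 4 → R) : Matrix (Fin 2) (Fin 2) R :=
  c 0 • (1 : Matrix (Fin 2) (Fin 2) R) + c 1 • A.1 + c 2 • B.1 + c 3 • (A.1 * B.1)

theorem mul_wordCombination_left (A B : SL(2, R)) (c : Fin 4 → R) :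
    A.1 * wordCombination A B c = wordCombination A B
      ![-c 1, c 0 + A.1.trace * c 1, -c 3, c 2 + A.1.trace * c 3] := by
  simp only [wordCombination, mul_add, mul_smul_comm, mul_one, ← mul_assoc, mul_self_eq A, sub_mul,
    smul_mul_assoc, one_mul, Matrix.cons_val]
  module

theorem mul_wordCombination_right (A B : SL(2, R)) (c : Fin 4 → R) :
    B.1 * wordCombination A B c = wordCombination A B
      ![((A.1 * B.1).trace - A.1.trace * B.1.trace) * c 1 - c 2 - A.1.trace * c 3,
        B.1.trace * c 1 + c 3,
        c 0 + A.1.trace * c 1 + B.1.trace * c 2 + (A.1 * B.1).trace * c 3,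
        -c 1] := by
  simp only [wordCombination, mul_add, mul_smul_comm, mul_one, mul_self_eq B,
    mul_mul_self_eq A B, mul_add_mul_swap A.1 B.1, Matrix.cons_val]
  module

theorem sub_wordCombination (A B : SL(2, R)) (r : R) (c d : Fin 4 → R) :
    r • wordCombination A B c - wordCombination A B d = wordCombination A B (r • c - d) := by
  simp only [wordCombination, Pi.sub_apply, Pi.smul_apply, smul_eq_mul]
  module

/-- The coefficients of a word with respect to `1, A, B, A B` only depend on the traces of
`A`, `B` and `A B`. -/
theorem exists_wordCombination (ρ σ : Pi1 →* SL(2, R))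
    (ha : (ρ genA).1.trace = (σ genA).1.trace) (hb : (ρ genB).1.trace = (σ genB).1.trace)
    (hab : ((ρ genA).1 * (ρ genB).1).trace = ((σ genA).1 * (σ genB).1).trace) (g : Pi1) :
    ∃ c : Fin 4 → R, (ρ g).1 = wordCombination (ρ genA) (ρ genB) c ∧
      (σ g).1 = wordCombination (σ genA) (σ genB) c := by
  have key : ∀ L : List (Fin 2 × Bool), ∃ c : Fin 4 → R,
      (ρ (FreeGroup.mk L)).1 = wordCombination (ρ genA) (ρ genB) c ∧
      (σ (FreeGroup.mk L)).1 = wordCombination (σ genA) (σ genB) c := by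
    intro L
    induction L with
    | nil =>
      refine ⟨![1, 0, 0, 0], ?_, ?_⟩ <;>
      · rw [← FreeGroup.one_eq_mk, map_one]
        simp [wordCombination]
    | cons l L ih =>
      obtain ⟨c, hc, hc'⟩ := ih
      obtain ⟨i, b⟩ := l
      have hA := mul_wordCombination_left (ρ genA) (ρ genB) c
      have hA' := mul_wordCombination_left (σ genA) (σ genB) c
      have hB := mul_wordCombination_right (ρ genA) (ρ genB) c
      have hB' := mul_wordCombination_right (σ genA) (σ genB) c
      rw [← ha] at hA'
      rw [← ha, ← hb, ← hab] at hB'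
      have hcons : ∀ b', (FreeGroup.mk ((i, b') :: L) : Pi1)
          = FreeGroup.mk [(i, b')] * FreeGroup.mk L := fun b' => by
        rw [FreeGroup.mul_mk]; rfl
      have hinv : (FreeGroup.mk [(i, false)] : Pi1) = (FreeGroup.of i)⁻¹ := rfl
      have hof : (FreeGroup.mk [(i, true)] : Pi1) = FreeGroup.of i := rfl
      rw [hcons]
      fin_cases i <;> cases b <;> simp only [hinv, hof] <;>
        simp only [map_mul, map_inv, Matrix.SpecialLinearGroup.coe_mul, coe_inv_eq, hc, hc',
          sub_mul, smul_mul_assoc, one_mul]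
      · change ∃ c', _ - (ρ genA).1 * _ = _ ∧ (σ genA).1.trace • _ - (σ genA).1 * _ = _
        rw [hA, hA', sub_wordCombination, sub_wordCombination, ← ha]
        exact ⟨_, rfl, rfl⟩
      · exact ⟨_, hA, hA'⟩
      · change ∃ c', _ - (ρ genB).1 * _ = _ ∧ (σ genB).1.trace • _ - (σ genB).1 * _ = _
        rw [hB, hB', sub_wordCombination, sub_wordCombination, ← hb]
        exact ⟨_, rfl, rfl⟩
      · exact ⟨_, hB, hB'⟩
  obtain ⟨c, hc⟩ := key g.toWord
  rw [FreeGroup.mk_toWord] at hc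
  exact ⟨c, hc⟩

/-- The trace of a word only depends on the traces of `A`, `B` and `A B`. -/
theorem trace_eq_of_trace_eq (ρ σ : Pi1 →* SL(2, R))
    (ha : (ρ genA).1.trace = (σ genA).1.trace) (hb : (ρ genB).1.trace = (σ genB).1.trace)
    (hab : ((ρ genA).1 * (ρ genB).1).trace = ((σ genA).1 * (σ genB).1).trace) (g : Pi1) :
    (ρ g).1.trace = (σ g).1.trace := by
  obtain ⟨c, h, h'⟩ := exists_wordCombination ρ σ ha hb hab g
  rw [h, h']
  simp only [wordCombination, Matrix.trace_add, Matrix.trace_smul, ha, hb, hab]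

/-- Fricke's identity. With value `-2` on the left it becomes the Markov-type equation `x² + y² + z²
= xyz`. -/
theorem trace_commutator (A B : SL(2, R)) :
    (A * B * A⁻¹ * B⁻¹).1.trace = A.1.trace ^ 2 + B.1.trace ^ 2 + (A.1 * B.1).trace ^ 2
      - A.1.trace * B.1.trace * (A.1 * B.1).trace - 2 := by
  have hA := mul_self_eq A
  have hB := mul_self_eq B
  have hAB := mul_self_eq (A * B)
  simp only [Matrix.SpecialLinearGroup.coe_mul] at hAB ⊢
  rw [coe_inv_eq, coe_inv_eq]
  have h1 : (A.1 * B.1 * B.1).trace = B.1.trace * (A.1 * B.1).trace - A.1.trace := by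
    rw [mul_assoc, hB, mul_sub, mul_one, mul_smul_comm, Matrix.trace_sub, Matrix.trace_smul,
      smul_eq_mul]
  have h2 : (A.1 * B.1 * A.1).trace = A.1.trace * (A.1 * B.1).trace - B.1.trace := by
    rw [Matrix.trace_mul_comm, ← mul_assoc, hA, sub_mul, one_mul, smul_mul_assoc,
      Matrix.trace_sub, Matrix.trace_smul, smul_eq_mul]
  have h3 : (A.1 * B.1 * A.1 * B.1).trace = (A.1 * B.1).trace ^ 2 - 2 := by
    rw [mul_assoc _ A.1, hAB, Matrix.trace_sub, Matrix.trace_smul, smul_eq_mul, Matrix.trace_one]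
    simp [sq]
  simp only [mul_sub, mul_smul_comm, mul_one, sub_mul, smul_mul_assoc, Matrix.trace_sub,
    Matrix.trace_smul, h1, h2, h3, smul_eq_mul]
  ring

theorem det_sub_one (g : SL(2, R)) : (g.1 - 1).det = 2 - g.1.trace := by
  have h := g.2
  rw [Matrix.det_fin_two] at h
  simp only [Matrix.det_fin_two, Matrix.trace_fin_two, Matrix.sub_apply, Matrix.one_apply_eq,
    Matrix.one_apply_ne (zero_ne_one : (0 : Fin 2) ≠ 1),
    Matrix.one_apply_ne (one_ne_zero : (1 : Fin 2) ≠ 0)]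
  linear_combination h

theorem det_mul_sub_mul (A B : SL(2, R)) :
    (A.1 * B.1 - B.1 * A.1).det = 2 - (A * B * A⁻¹ * B⁻¹).1.trace := by
  have h : A.1 * B.1 - B.1 * A.1 = ((A * B * A⁻¹ * B⁻¹).1 - 1) * (B * A).1 := by
    have h : (A * B * A⁻¹ * B⁻¹).1 * (B * A).1 = (A * B).1 := by
      have h' : A * B * A⁻¹ * B⁻¹ * (B * A) = A * B := by group
      rw [← Matrix.SpecialLinearGroup.coe_mul, h']
    rw [sub_mul, one_mul, h]
    simp only [Matrix.SpecialLinearGroup.coe_mul]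
  rw [h, Matrix.det_mul, det_sub_one, (B * A).2, mul_one]

theorem commutator_mul (A B : Matrix (Fin 2) (Fin 2) R) :
    (A * B - B * A) * B = (B.trace • (1 : Matrix (Fin 2) (Fin 2) R) - B) * (A * B - B * A) := by
  ext i j
  fin_cases i <;> fin_cases j <;> simp [Matrix.mul_apply, Matrix.trace_fin_two] <;> ring

/-- The brackets among `A`, `B`, `AB` are all multiples of `D = AB - BA`: `[A, AB] = A D`, while
`[B, AB] = -D B = -B⁻¹ D`. Taking determinants relates the commutator trace of any two words to that
of the generators. -/
theorem wordCombination_commutator (A B : SL(2, R)) (c d : Fin 4 → R) :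
    wordCombination A B c * wordCombination A B d - wordCombination A B d * wordCombination A B c =
      ((c 1 * d 2 - c 2 * d 1) • (1 : Matrix (Fin 2) (Fin 2) R) + (c 1 * d 3 - c 3 * d 1) • A.1 -
        (c 2 * d 3 - c 3 * d 2) • (B.1.trace • (1 : Matrix (Fin 2) (Fin 2) R) - B.1)) *
      (A.1 * B.1 - B.1 * A.1) := by
  have h := commutator_mul A.1 B.1
  rw [sub_mul _ _ (A.1 * B.1 - B.1 * A.1), smul_mul_assoc _ (_ - B.1), ← h]
  simp only [wordCombination, add_mul, mul_add, smul_mul_assoc, mul_smul_comm, one_mul, mul_one,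
    mul_sub, sub_mul, smul_sub, smul_add, mul_assoc]
  module

/-- The commutator trace of two words is controlled by that of the generators. -/
theorem exists_two_sub_trace_commutator (ρ : Pi1 →* SL(2, R)) (u v : Pi1) :
    ∃ p q r : R, 2 - (ρ (u * v * u⁻¹ * v⁻¹)).1.trace =
      (p • (1 : Matrix (Fin 2) (Fin 2) R) + q • (ρ genA).1 -
        r • ((ρ genB).1.trace • (1 : Matrix (Fin 2) (Fin 2) R) - (ρ genB).1)).det *
      (2 - (ρ (genA * genB * genA⁻¹ * genB⁻¹)).1.trace) := by
  obtain ⟨c, hc, -⟩ := exists_wordCombination ρ ρ rfl rfl rfl u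
  obtain ⟨d, hd, -⟩ := exists_wordCombination ρ ρ rfl rfl rfl v
  refine ⟨c 1 * d 2 - c 2 * d 1, c 1 * d 3 - c 3 * d 1, c 2 * d 3 - c 3 * d 2, ?_⟩
  simp only [map_mul, map_inv]
  rw [← det_mul_sub_mul, ← det_mul_sub_mul, hc, hd, wordCombination_commutator, Matrix.det_mul]

end TraceIdentities

/-! ### Invariance of the commutator trace under automorphisms of the free group. -/

section CommutatorInvariance

variable {R S : Type*} [CommRing R] [CommRing S]

/-- The elementary matrix with upper right entry `p`. -/
def upperElementary (p : R) : SL(2, R) := ⟨!![1, p; 0, 1], by simp⟩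

/-- The elementary matrix with lower left entry `p`. -/
def lowerElementary (p : R) : SL(2, R) := ⟨!![1, 0; p, 1], by simp⟩

theorem coe_upperElementary (p : R) : (upperElementary p).1 = !![1, p; 0, 1] := rfl

theorem coe_lowerElementary (p : R) : (lowerElementary p).1 = !![1, 0; p, 1] := rfl

/-- A product of four elementary matrices, alternately upper and lower triangular. -/
def elementaryProduct (p : Fin 4 → R) : SL(2, R) :=
  upperElementary (p 0) * lowerElementary (p 1) * upperElementary (p 2) * lowerElementary (p 3)

theorem coe_elementaryProduct (p : Fin 4 → R) :
    (elementaryProduct p).1 =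
      !![1, p 0; 0, 1] * !![1, 0; p 1, 1] * !![1, p 2; 0, 1] * !![1, 0; p 3, 1] := by
  simp only [elementaryProduct, Matrix.SpecialLinearGroup.coe_mul, coe_upperElementary,
    coe_lowerElementary]

theorem map_elementaryProduct (f : R →+* S) (p : Fin 4 → R) :
    Matrix.SpecialLinearGroup.map f (elementaryProduct p) = elementaryProduct (f ∘ p) := by
  have hu : ∀ p, Matrix.SpecialLinearGroup.map f (upperElementary p) = upperElementary (f p) := by
    intro p
    ext i j
    fin_cases i <;> fin_cases j <;> simp [coe_upperElementary]
  have hl : ∀ p, Matrix.SpecialLinearGroup.map f (lowerElementary p) = lowerElementary (f p) := by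
    intro p
    ext i j
    fin_cases i <;> fin_cases j <;> simp [coe_lowerElementary]
  simp only [elementaryProduct, map_mul, hu, hl, Function.comp]

/-- Three factors suffice when the lower left entry is nonzero; the fourth arranges this. Hence
every real pair is a specialization of the generic pair, whose parameters are free polynomial
variables. -/
theorem elementaryProduct_surjective {K : Type*} [Field K] :
    Function.Surjective (elementaryProduct : (Fin 4 → K) → SL(2, K)) := by
  have key : ∀ g : SL(2, K), g.1 1 0 ≠ 0 →
      ∃ p q r : K, upperElementary p * lowerElementary q * upperElementary r = g := by
    intro g hg
    have hdet := g.2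
    rw [Matrix.det_fin_two] at hdet
    refine ⟨(g.1 0 0 - 1) / g.1 1 0, g.1 1 0, (g.1 1 1 - 1) / g.1 1 0, ?_⟩
    ext i j
    fin_cases i <;> fin_cases j <;>
      simp [coe_upperElementary, coe_lowerElementary, Matrix.mul_apply, Fin.sum_univ_two] <;>
      field_simp
    · ring
    · linear_combination hdet
    · ring
  intro g
  have hdet := g.2
  rw [Matrix.det_fin_two] at hdet
  obtain ⟨t, ht⟩ : ∃ t : K, g.1 1 0 + g.1 1 1 * t ≠ 0 := by
    by_cases hc : g.1 1 0 = 0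
    · refine ⟨1, ?_⟩
      rw [hc, zero_add, mul_one]
      rintro hd
      simp [hc, hd] at hdet
    · exact ⟨0, by simpa using hc⟩
  obtain ⟨p, q, r, h⟩ := key (g * lowerElementary t)
    (by simpa [coe_lowerElementary, Matrix.mul_apply, Fin.sum_univ_two] using ht)
  refine ⟨![p, q, r, -t], ?_⟩
  rw [elementaryProduct]
  simp only [Matrix.cons_val]
  rw [h, mul_assoc]
  convert mul_one g using 2
  ext i j
  fin_cases i <;> fin_cases j <;> simp [coe_lowerElementary, Matrix.mul_apply, Fin.sum_univ_two]

/-- The representation that sends the generators to generic products of elementary matrices. -/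
noncomputable def elementaryRep (p : Fin 2 × Fin 4 → R) : Pi1 →* SL(2, R) :=
  FreeGroup.lift fun i => elementaryProduct fun j => p (i, j)

theorem map_elementaryRep (f : R →+* S) (p : Fin 2 × Fin 4 → R) (g : Pi1) :
    Matrix.SpecialLinearGroup.map f (elementaryRep p g) = elementaryRep (f ∘ p) g := by
  have : (Matrix.SpecialLinearGroup.map f).comp (elementaryRep p) = elementaryRep (f ∘ p) := by
    refine FreeGroup.ext_hom _ _ fun i => ?_
    simp only [elementaryRep, MonoidHom.comp_apply, FreeGroup.lift_apply_of, map_elementaryProduct]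
    rfl
  exact DFunLike.congr_fun this g

theorem map_trace_elementaryRep (f : R →+* S) (p : Fin 2 × Fin 4 → R) (g : Pi1) :
    f (elementaryRep p g).1.trace = (elementaryRep (f ∘ p) g).1.trace := by
  rw [← map_elementaryRep]
  simp [Matrix.trace_fin_two]

/-- The trace of the commutator of a basis does not depend on the basis. -/
theorem trace_commutator_automorphism (ρ : Pi1 →* SL(2, ℝ)) (θ : Pi1 ≃* Pi1) :
    (ρ (θ genA * θ genB * (θ genA)⁻¹ * (θ genB)⁻¹)).1.trace =
      (ρ (genA * genB * genA⁻¹ * genB⁻¹)).1.trace := by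
  -- Over this ring the factor between the two values of `2 - tr [·, ·]` is a unit, because the
  -- inverse automorphism provides a factor in the other direction. The units are only `±1`.
  let P := MvPolynomial (Fin 2 × Fin 4) ℤ
  let τ : Pi1 →* SL(2, P) := elementaryRep MvPolynomial.X
  obtain ⟨p, q, r, h⟩ := exists_two_sub_trace_commutator τ (θ genA) (θ genB)
  obtain ⟨p', q', r', h'⟩ := exists_two_sub_trace_commutator (τ.comp θ.toMonoidHom)
    (θ.symm genA) (θ.symm genB)
  have e : ∀ g, (τ.comp θ.toMonoidHom) g = τ (θ g) := fun g => rfl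
  simp only [e, map_mul θ, map_inv θ, MulEquiv.apply_symm_apply] at h'
  set m := (p • (1 : Matrix (Fin 2) (Fin 2) P) + q • (τ genA).1 -
    r • ((τ genB).1.trace • (1 : Matrix (Fin 2) (Fin 2) P) - (τ genB).1)).det with hm
  have hne : 2 - (τ (genA * genB * genA⁻¹ * genB⁻¹)).1.trace ≠ 0 := by
    intro h0
    let f : P →+* ℤ := (MvPolynomial.aeval (fun k : Fin 2 × Fin 4 =>
      (![![1, 0, 0, 0], ![0, 1, 0, 0]] k.1 k.2 : ℤ))).toRingHom
    have h1 := congrArg f h0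
    rw [map_sub, map_trace_elementaryRep, map_zero, map_ofNat] at h1
    have h2 : (f ∘ MvPolynomial.X) = fun k : Fin 2 × Fin 4 =>
      (![![1, 0, 0, 0], ![0, 1, 0, 0]] k.1 k.2 : ℤ) := by
      exact funext fun k => MvPolynomial.aeval_X _ k
    rw [h2] at h1
    simp only [map_mul, map_inv, trace_commutator] at h1
    simp [elementaryRep, genA, genB, coe_elementaryProduct, Matrix.trace_fin_two] at h1
  have hunit : IsUnit m := by
    generalize (p' • (1 : Matrix (Fin 2) (Fin 2) P) + _ - _).det = m' at h'
    exact IsUnit.of_mul_eq_one m' (mul_right_cancel₀ hne (by linear_combination -h' - m' * h))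
  obtain ⟨k, hk, hmk⟩ := MvPolynomial.isUnit_iff_eq_C_of_isReduced.1 hunit
  -- At the origin of the parameter space both generators become the identity, the determinant `m`
  -- becomes a square, and the value `-1` is excluded.
  have hk1 : k = 1 := by
    let f : P →+* ℤ := (MvPolynomial.aeval (fun _ : Fin 2 × Fin 4 => (0 : ℤ))).toRingHom
    have hf : ∀ i : Fin 2, ((τ (FreeGroup.of i)).1.map f) = 1 := by
      intro i
      have := congrArg Subtype.val (map_elementaryRep f MvPolynomial.X (FreeGroup.of i))
      have h2 : (f ∘ MvPolynomial.X) = fun k : Fin 2 × Fin 4 => (0 : ℤ) := by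
        exact funext fun k => MvPolynomial.aeval_X _ k
      rw [h2] at this
      refine Eq.trans this ?_
      ext a b
      fin_cases a <;> fin_cases b <;>
        simp [elementaryRep, coe_elementaryProduct, Matrix.mul_apply]
    have h1 : f m = (f p + f q - f r) ^ 2 := by
      have hA : ∀ i j, f ((τ genA).1 i j) = (1 : Matrix (Fin 2) (Fin 2) ℤ) i j :=
        fun i j => congrFun (congrFun (hf 0) i) j
      have hB : ∀ i j, f ((τ genB).1 i j) = (1 : Matrix (Fin 2) (Fin 2) ℤ) i j :=
        fun i j => congrFun (congrFun (hf 1) i) j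
      rw [hm]
      simp [Matrix.det_fin_two, Matrix.trace_fin_two, hA, hB]
      ring
    have h2 : f m = k := by
      rw [hmk]
      simp [f]
    rcases Int.isUnit_iff.1 hk with rfl | rfl
    · rfl
    · nlinarith [sq_nonneg (f p + f q - f r)]
  rw [hmk, hk1, map_one, one_mul] at h
  choose c hc using fun i : Fin 2 => elementaryProduct_surjective (ρ (FreeGroup.of i))
  have hρ : elementaryRep (fun k : Fin 2 × Fin 4 => c k.1 k.2) = ρ := by
    refine FreeGroup.ext_hom _ _ fun i => ?_
    simpa [elementaryRep] using hc i
  let f : P →+* ℝ := (MvPolynomial.aeval (fun k : Fin 2 × Fin 4 => c k.1 k.2)).toRingHom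
  have h3 := congrArg f h
  have h2 : (f ∘ MvPolynomial.X) = fun k : Fin 2 × Fin 4 => c k.1 k.2 := by
    exact funext fun k => MvPolynomial.aeval_X _ k
  rw [map_sub, map_sub, map_trace_elementaryRep, map_trace_elementaryRep, h2, hρ] at h3
  linarith

end CommutatorInvariance

/-! ### Displacement functions and translation lengths. -/

section Displacement

theorem isHyperbolic_iff (A : SL(2, ℝ)) : A.1.IsHyperbolic ↔ 4 < A.1.trace ^ 2 := by
  rw [Matrix.IsHyperbolic, Matrix.discr_fin_two, A.2]
  constructor <;> intro h <;> linarith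

/-- The squared quadratic expression is the only part that depends on `z`. For hyperbolic `A` it
vanishes exactly on the axis, so the infimum of the displacement can be read off. -/
theorem sinh_half_dist_smul_sq (A : SL(2, ℝ)) (z : ℍ) :
    Real.sinh (dist z (A • z) / 2) ^ 2 =
      ((A.1 1 0 * (z.re ^ 2 + z.im ^ 2) + (A.1 1 1 - A.1 0 0) * z.re - A.1 0 1) ^ 2 / z.im ^ 2
        + A.1.trace ^ 2 - 4) / 4 := by
  have hdet := A.2
  rw [Matrix.det_fin_two] at hdet
  have hz := z.im_pos
  have hden : (A.1 1 0 : ℂ) * z + A.1 1 1 ≠ 0 := UpperHalfPlane.denom_ne_zero (A : GL (Fin 2) ℝ) z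
  have him : (A • z).im = z.im / Complex.normSq ((A.1 1 0 : ℂ) * z + A.1 1 1) := by
    have h : (A • z).im = _ :=
      UpperHalfPlane.im_smul_eq_div_normSq (Matrix.SpecialLinearGroup.mapGL ℝ A) z
    rw [h]
    simp [UpperHalfPlane.denom]
  have hco : ((A • z : ℍ) : ℂ) = ((A.1 0 0 : ℂ) * z + A.1 0 1) / ((A.1 1 0 : ℂ) * z + A.1 1 1) :=
    UpperHalfPlane.coe_specialLinearGroup_apply A z
  have hn : 0 < Complex.normSq ((A.1 1 0 : ℂ) * z + A.1 1 1) := Complex.normSq_pos.2 hden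
  rw [UpperHalfPlane.sinh_half_dist, div_pow, mul_pow, Real.sq_sqrt (by positivity), him,
    Complex.dist_eq, hco]
  have h1 : (z : ℂ) - ((A.1 0 0 : ℂ) * z + A.1 0 1) / ((A.1 1 0 : ℂ) * z + A.1 1 1) =
      (z * ((A.1 1 0 : ℂ) * z + A.1 1 1) - ((A.1 0 0 : ℂ) * z + A.1 0 1)) /
        ((A.1 1 0 : ℂ) * z + A.1 1 1) := by
    rw [eq_div_iff hden, sub_mul, div_mul_cancel₀ _ hden]
  rw [h1, norm_div, div_pow, ← Complex.normSq_eq_norm_sq, ← Complex.normSq_eq_norm_sq]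
  have h2 : Complex.normSq (z * ((A.1 1 0 : ℂ) * z + A.1 1 1) - ((A.1 0 0 : ℂ) * z + A.1 0 1)) =
      (A.1 1 0 * (z.re ^ 2 + z.im ^ 2) + (A.1 1 1 - A.1 0 0) * z.re - A.1 0 1) ^ 2
        + (A.1.trace ^ 2 - 4) * z.im ^ 2 := by
    rw [Complex.normSq_apply, Matrix.trace_fin_two]
    simp
    linear_combination -4 * z.im ^ 2 * hdet
  rw [h2]
  field_simp
  ring

theorem translationLength_of_isHyperbolic (A : SL(2, ℝ)) (hA : A.1.IsHyperbolic) :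
    translationLength A = 2 * Real.arsinh (√(A.1.trace ^ 2 - 4) / 2) := by
  have htr := (isHyperbolic_iff A).1 hA
  have hdet := A.2
  rw [Matrix.det_fin_two] at hdet
  have hlow : ∀ z : ℍ, 2 * Real.arsinh (√(A.1.trace ^ 2 - 4) / 2) ≤ dist z (A • z) := by
    intro z
    rw [← le_div_iff₀' two_pos, ← Real.sinh_le_sinh, Real.sinh_arsinh]
    refine le_of_sq_le_sq ?_ (Real.sinh_nonneg_iff.2 (by positivity))
    rw [sinh_half_dist_smul_sq, div_pow, Real.sq_sqrt (by linarith)]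
    have : 0 ≤ (A.1 1 0 * (z.re ^ 2 + z.im ^ 2) + (A.1 1 1 - A.1 0 0) * z.re - A.1 0 1) ^ 2
      / z.im ^ 2 := by positivity
    linarith
  -- A point on the axis: at height one on a vertical axis if the lower left entry vanishes,
  -- otherwise the top of the semicircle.
  have hex : ∃ z : ℍ, A.1 1 0 * (z.re ^ 2 + z.im ^ 2) + (A.1 1 1 - A.1 0 0) * z.re - A.1 0 1 = 0 := by
    rw [Matrix.trace_fin_two] at htr
    by_cases hc : A.1 1 0 = 0
    · have hne : A.1 1 1 - A.1 0 0 ≠ 0 := by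
        intro h
        rw [sub_eq_zero] at h
        rw [hc, h] at hdet
        rw [h] at htr
        nlinarith
      refine ⟨⟨⟨A.1 0 1 / (A.1 1 1 - A.1 0 0), 1⟩, one_pos⟩, ?_⟩
      simp only [UpperHalfPlane.re, UpperHalfPlane.im]
      rw [hc]
      field_simp
      ring
    · refine ⟨⟨⟨(A.1 0 0 - A.1 1 1) / (2 * A.1 1 0),
        √((A.1 0 0 + A.1 1 1) ^ 2 - 4) / (2 * |A.1 1 0|)⟩, ?_⟩, ?_⟩
      · have := Real.sqrt_pos.2 (sub_pos.2 htr)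
        have := abs_pos.2 hc
        positivity
      · simp only [UpperHalfPlane.re, UpperHalfPlane.im]
        rw [div_pow, div_pow, Real.sq_sqrt (by linarith), mul_pow _ |_|, sq_abs]
        field_simp
        linear_combination 4 * hdet
  obtain ⟨z, hz⟩ := hex
  refine le_antisymm ?_ (le_ciInf hlow)
  refine (ciInf_le ⟨0, by rintro _ ⟨z, rfl⟩; exact dist_nonneg⟩ z).trans ?_
  rw [← div_le_iff₀' two_pos, ← Real.sinh_le_sinh, Real.sinh_arsinh]
  refine le_of_sq_le_sq ?_ (by positivity)
  rw [sinh_half_dist_smul_sq, hz, div_pow, Real.sq_sqrt (by linarith)]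
  apply le_of_eq
  ring

theorem exists_fixed_point_of_trace_eq_zero (A : SL(2, ℝ)) (hA : A.1.trace = 0) :
    ∃ z : ℍ, A • z = z := by
  have hdet := A.2
  rw [Matrix.det_fin_two] at hdet
  have hA' := hA
  rw [Matrix.trace_fin_two] at hA
  have hc : A.1 1 0 ≠ 0 := by
    intro h
    rw [h] at hdet
    rw [eq_neg_of_add_eq_zero_right hA] at hdet
    nlinarith [sq_nonneg (A.1 0 0)]
  let z : ℍ := ⟨⟨A.1 0 0 / A.1 1 0, 1 / |A.1 1 0|⟩, by
    have := abs_pos.2 hc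
    positivity⟩
  refine ⟨z, ?_⟩
  have h := sinh_half_dist_smul_sq A z
  have h0 : Real.sinh (dist z (A • z) / 2) ^ 2 = 0 := by
    rw [h, hA']
    simp only [z, UpperHalfPlane.re, UpperHalfPlane.im]
    have h1 : A.1 1 1 = - A.1 0 0 := by linarith
    have h2 : A.1 0 1 = -(1 + A.1 0 0 ^ 2) / A.1 1 0 := by
      field_simp
      rw [h1] at hdet
      linarith
    rw [div_pow, div_pow, sq_abs, h1, h2]
    field_simp
    ring
  rw [sq_eq_zero_iff, Real.sinh_eq_zero] at h0
  rw [eq_comm, ← dist_eq_zero]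
  linarith

end Displacement

/-! ### Traces of the holonomy of a punctured torus. -/

section Holonomy

theorem mul_commutator_anticomm {R : Type*} [CommRing R] (A B : SL(2, R)) :
    (A.1 * B.1 - B.1 * A.1) * A.1 = (A⁻¹).1 * (A.1 * B.1 - B.1 * A.1) := by
  rw [coe_inv_eq]
  ext i j
  fin_cases i <;> fin_cases j <;> simp [Matrix.mul_apply, Matrix.trace_fin_two] <;> ring

/-- If the commutator of `A` and `B` has trace two then it commutes with its conjugate by `A`. -/
theorem commute_conj_commutator (A B : SL(2, ℝ)) (h : (A * B * A⁻¹ * B⁻¹).1.trace = 2) :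
    Commute (A * B * A⁻¹ * B⁻¹) (A * (A * B * A⁻¹ * B⁻¹) * A⁻¹) := by
  -- Trace and determinant of `D` vanish, so `D² = 0`. Moving `D` past `A` or `B` inverts that
  -- letter, so every product `D w D` with `w` a word vanishes. Both elements have the form `1 + w
  -- D`, and therefore commute.
  set D := A.1 * B.1 - B.1 * A.1 with hD
  have hDD : D * D = 0 := by
    have hdet : D.det = 0 := by rw [hD, det_mul_sub_mul, h, sub_self]
    have htr : D.trace = 0 := by rw [hD, Matrix.trace_sub, Matrix.trace_mul_comm, sub_self]
    rw [Matrix.det_fin_two] at hdet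
    rw [Matrix.trace_fin_two] at htr
    have h1 : D 1 1 = - D 0 0 := by linarith
    rw [h1] at hdet
    ext i j
    fin_cases i <;> fin_cases j <;> simp [Matrix.mul_apply, Fin.sum_univ_two, h1] <;> linarith
  have hA : D * A.1 = (A⁻¹).1 * D := mul_commutator_anticomm A B
  have hB : D * B.1 = (B⁻¹).1 * D := by
    have := mul_commutator_anticomm B A
    rw [← neg_sub, neg_mul, mul_neg, neg_inj] at this
    exact this
  have inv_mul : ∀ g : SL(2, ℝ), (g⁻¹).1 * g.1 = 1 := fun g => by
    rw [← Matrix.SpecialLinearGroup.coe_mul, inv_mul_cancel, Matrix.SpecialLinearGroup.coe_one]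
  have mul_inv : ∀ g : SL(2, ℝ), g.1 * (g⁻¹).1 = 1 := fun g => by
    rw [← Matrix.SpecialLinearGroup.coe_mul, mul_inv_cancel, Matrix.SpecialLinearGroup.coe_one]
  have hA' : D * (A⁻¹).1 = A.1 * D := by
    calc D * (A⁻¹).1 = A.1 * ((A⁻¹).1 * D) * (A⁻¹).1 := by
          rw [← mul_assoc A.1, mul_inv, one_mul]
      _ = A.1 * D := by rw [← hA, ← mul_assoc, mul_assoc _ A.1, mul_inv, mul_one]
  have hB' : D * (B⁻¹).1 = B.1 * D := by
    calc D * (B⁻¹).1 = B.1 * ((B⁻¹).1 * D) * (B⁻¹).1 := by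
          rw [← mul_assoc B.1, mul_inv, one_mul]
      _ = B.1 * D := by rw [← hB, ← mul_assoc, mul_assoc _ B.1, mul_inv, mul_one]
  have hC : (A * B * A⁻¹ * B⁻¹).1 = 1 + A.1 * B.1 * D := by
    have h1 : D = (A * B).1 - (B * A).1 := by simp only [hD, Matrix.SpecialLinearGroup.coe_mul]
    have h2 : A.1 * B.1 * D = D * (A⁻¹).1 * (B⁻¹).1 := by
      rw [hA', mul_assoc A.1 D, hB', mul_assoc]
    have h3 : (A * B).1 * (A⁻¹).1 * (B⁻¹).1 = (A * B * A⁻¹ * B⁻¹).1 := by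
      simp only [Matrix.SpecialLinearGroup.coe_mul]
    have h4 : (B * A).1 * (A⁻¹).1 * (B⁻¹).1 = 1 := by
      rw [Matrix.SpecialLinearGroup.coe_mul, mul_assoc B.1, mul_inv, mul_one, mul_inv]
    rw [h2, h1, sub_mul, sub_mul, h3, h4]
    abel
  have hC' : (A * (A * B * A⁻¹ * B⁻¹) * A⁻¹).1 = 1 + A.1 * A.1 * B.1 * A.1 * D := by
    rw [Matrix.SpecialLinearGroup.coe_mul, Matrix.SpecialLinearGroup.coe_mul, hC, mul_add, mul_one,
      add_mul, mul_inv]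
    simp only [mul_assoc, hA']
  have z1 : D * (A.1 * (A.1 * (B.1 * (A.1 * D)))) = 0 := by
    rw [← mul_assoc, hA, mul_assoc, ← mul_assoc D, hA, mul_assoc, ← mul_assoc D, hB, mul_assoc,
      ← mul_assoc D, hA, mul_assoc, hDD]
    simp
  have z2 : D * (A.1 * (B.1 * D)) = 0 := by
    rw [← mul_assoc, hA, mul_assoc, ← mul_assoc D, hB, mul_assoc, hDD]
    simp
  apply Subtype.ext
  change (A * B * A⁻¹ * B⁻¹).1 * (A * (A * B * A⁻¹ * B⁻¹) * A⁻¹).1 =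
    (A * (A * B * A⁻¹ * B⁻¹) * A⁻¹).1 * (A * B * A⁻¹ * B⁻¹).1
  rw [hC, hC']
  simp only [mul_add, add_mul, one_mul, mul_one, mul_assoc, z1, z2, mul_zero, add_zero]
  abel

/-- A parabolic commutator has trace `2` or `-2`. Trace `2` would impose a nontrivial relation
between the commutator and its conjugate by `a`, contradicting the free action. -/
theorem IsTeichmullerPoint.trace_commutator_eq {X : Pi1 →* SL(2, ℝ)} (hX : IsTeichmullerPoint X) :
    (X (genA * genB * genA⁻¹ * genB⁻¹)).1.trace = -2 := by
  have h := hX.cusp.2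
  rw [Matrix.discr_fin_two, (X _).2] at h
  have h2 : ((X (genA * genB * genA⁻¹ * genB⁻¹)).1.trace - 2) *
      ((X (genA * genB * genA⁻¹ * genB⁻¹)).1.trace + 2) = 0 := by linear_combination h
  rcases mul_eq_zero.1 h2 with h3 | h3
  · exfalso
    set c : Pi1 := genA * genB * genA⁻¹ * genB⁻¹ with hc
    have hcomm := commute_conj_commutator (X genA) (X genB) (by
      simpa only [hc, map_mul, map_inv, sub_eq_zero] using h3)
    have h1 : X (c * (genA * c * genA⁻¹)) = X (genA * c * genA⁻¹ * c) := by
      simpa only [hc, map_mul, map_inv] using hcomm.eq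
    have hne : c * (genA * c * genA⁻¹) ≠ genA * c * genA⁻¹ * c := by
      rw [hc]
      decide
    refine hX.free (c * (genA * c * genA⁻¹) * (genA * c * genA⁻¹ * c)⁻¹) ?_ UpperHalfPlane.I ?_
    · rwa [Ne, mul_inv_eq_one]
    · rw [map_mul, map_inv, h1, mul_inv_cancel, one_smul]
  · linarith

theorem IsTeichmullerPoint.trace_basis {X : Pi1 →* SL(2, ℝ)} (hX : IsTeichmullerPoint X)
    (θ : Pi1 ≃* Pi1) :
    (X (θ genA * θ genB * (θ genA)⁻¹ * (θ genB)⁻¹)).1.trace = -2 := by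
  rw [trace_commutator_automorphism, hX.trace_commutator_eq]

theorem IsTeichmullerPoint.isHyperbolic_basis {X : Pi1 →* SL(2, ℝ)} (hX : IsTeichmullerPoint X)
    (θ : Pi1 ≃* Pi1) : (X (θ genA)).1.IsHyperbolic := by
  have h := hX.trace_basis θ
  simp only [map_mul, map_inv, trace_commutator] at h
  rw [isHyperbolic_iff]
  by_contra! hle
  -- If `x² ≤ 4`, completing the square writes zero as a sum of nonnegative terms, one of which is
  -- `x²`. Trace zero then gives a fixed point.
  have hx : (X (θ genA)).1.trace = 0 := by
    generalize (X (θ genA)).1.trace = x at *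
    generalize (X (θ genB)).1.trace = y at *
    generalize ((X (θ genA)).1 * (X (θ genB)).1).trace = z at *
    have h1 : (z - x * y / 2) ^ 2 + y ^ 2 * (4 - x ^ 2) / 4 + x ^ 2 = 0 := by linear_combination h
    have h2 : 0 ≤ y ^ 2 * (4 - x ^ 2) := mul_nonneg (sq_nonneg _) (by linarith)
    nlinarith [sq_nonneg (z - x * y / 2), sq_nonneg x]
  obtain ⟨z, hz⟩ := exists_fixed_point_of_trace_eq_zero _ hx
  refine hX.free _ ?_ z hz
  rw [Ne, EmbeddingLike.map_eq_one_iff]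
  exact FreeGroup.of_ne_one 0

end Holonomy

/-! ### Ping-pong for the punctured torus group. -/

section PingPong

open Matrix

/-- Ping-pong with cones indexed by the letters: if each letter maps the cones of the letters that
may follow it in a reduced word into its own cone, up to sign, then so do reduced words. The
functions `N` are not decreased. -/
theorem exists_sign_smul_mem_cone (ρ : Pi1 →* SL(2, ℝ))
    (C : Fin 2 × Bool → Set (Fin 2 → ℝ)) (N : Fin 2 × Bool → (Fin 2 → ℝ) → ℝ)
    (h : ∀ l c : Fin 2 × Bool, (l.1 = c.1 → l.2 = c.2) → ∃ s : ℝ, (s = 1 ∨ s = -1) ∧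
      ∀ v ∈ C c, s • ((ρ (FreeGroup.mk [l])).1 *ᵥ v) ∈ C l ∧
        N c v ≤ N l (s • ((ρ (FreeGroup.mk [l])).1 *ᵥ v)))
    (L : List (Fin 2 × Bool)) (l c : Fin 2 × Bool) (hL : FreeGroup.IsReduced (l :: (L ++ [c]))) :
    ∃ s : ℝ, (s = 1 ∨ s = -1) ∧
      ∀ v ∈ C c, s • ((ρ (FreeGroup.mk (l :: L))).1 *ᵥ v) ∈ C l ∧
        N c v ≤ N l (s • ((ρ (FreeGroup.mk (l :: L))).1 *ᵥ v)) := by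
  induction L generalizing l with
  | nil =>
    refine h l c ?_
    simpa [FreeGroup.IsReduced] using hL
  | cons l' L ih =>
    rw [FreeGroup.IsReduced, List.cons_append, List.isChain_cons_cons] at hL
    obtain ⟨s, hs, hs'⟩ := ih l' hL.2
    obtain ⟨r, hr, hr'⟩ := h l l' hL.1
    refine ⟨r * s, ?_, fun v hv => ?_⟩
    · rcases hs with rfl | rfl <;> rcases hr with rfl | rfl <;> simp
    · have e : (r * s) • ((ρ (FreeGroup.mk (l :: l' :: L))).1 *ᵥ v) =
          r • ((ρ (FreeGroup.mk [l])).1 *ᵥ (s • ((ρ (FreeGroup.mk (l' :: L))).1 *ᵥ v))) := by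
        rw [show (FreeGroup.mk (l :: l' :: L) : Pi1) = FreeGroup.mk [l] * FreeGroup.mk (l' :: L) by
          rw [FreeGroup.mul_mk]; rfl, map_mul, Matrix.SpecialLinearGroup.coe_mul,
          ← Matrix.mulVec_mulVec, Matrix.mulVec_smul, smul_smul]
      rw [e]
      have h1 := hs' v hv
      have h2 := hr' _ h1.1
      exact ⟨h2.1, h1.2.trans h2.2⟩

/-- In the basis `(1, 0), (1, 1)` the matrix has nonnegative entries and determinant one, so the
product of its diagonal entries is at least one. -/
theorem two_le_trace_of_mem_cone (M : SL(2, ℝ)) (h₁ : 0 ≤ M.1 1 0) (h₂ : M.1 1 0 ≤ M.1 0 0)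
    (h₃ : 0 ≤ M.1 1 0 + M.1 1 1) (h₄ : M.1 1 0 + M.1 1 1 ≤ M.1 0 0 + M.1 0 1) :
    2 ≤ M.1.trace := by
  have hdet := M.2
  rw [Matrix.det_fin_two] at hdet
  rw [Matrix.trace_fin_two]
  generalize M.1 0 0 = a at *
  generalize M.1 0 1 = b at *
  generalize M.1 1 0 = c at *
  generalize M.1 1 1 = d at *
  have h5 : 1 ≤ (a - c) * (c + d) := by nlinarith
  nlinarith [sq_nonneg (a - c - (c + d))]

variable (α β : ℝ)

/-- The image of the first generator in the model of a punctured torus group. -/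
noncomputable def modelA (hα : α ≠ 0) : SL(2, ℝ) :=
  ⟨α⁻¹ • !![β ^ 2 + 1, α ^ 2; β ^ 2, α ^ 2], by simp [Matrix.det_fin_two]; field_simp; ring⟩

/-- The image of the second generator in the model of a punctured torus group. -/
noncomputable def modelB (hβ : β ≠ 0) : SL(2, ℝ) :=
  ⟨β⁻¹ • !![β ^ 2, α ^ 2; β ^ 2, α ^ 2 + 1], by simp [Matrix.det_fin_two]; field_simp; ring⟩

/-- The model of a punctured torus group. -/
noncomputable def modelRep (hα : α ≠ 0) (hβ : β ≠ 0) : Pi1 →* SL(2, ℝ) :=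
  FreeGroup.lift ![modelA α β hα, modelB α β hβ]

/-- The cones of the letters for the model of a punctured torus group. They are spanned by
neighbours in the cyclic sequence `(1, 0), (1, 1), (0, 1), (-α², β²)`. -/
def modelCone : Fin 2 × Bool → Set (Fin 2 → ℝ)
  | (0, true) => {v | 0 ≤ v 1 ∧ v 1 ≤ v 0}
  | (1, true) => {v | 0 ≤ v 0 ∧ v 0 ≤ v 1}
  | (0, false) => {v | v 0 ≤ 0 ∧ 0 ≤ v 1 ∧ 0 ≤ α ^ 2 * v 1 + β ^ 2 * v 0}
  | (1, false) => {v | v 0 ≤ 0 ∧ 0 ≤ v 1 ∧ α ^ 2 * v 1 + β ^ 2 * v 0 ≤ 0}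

theorem smul_mem_modelCone {r : ℝ} (hr : 0 ≤ r) {l : Fin 2 × Bool} {v : Fin 2 → ℝ}
    (hv : v ∈ modelCone α β l) : r • v ∈ modelCone α β l := by
  obtain ⟨i, b⟩ := l
  fin_cases i <;> cases b <;> simp only [modelCone, Set.mem_ofPred_eq, Pi.smul_apply, smul_eq_mul] at hv ⊢
  · exact ⟨mul_nonpos_of_nonneg_of_nonpos hr hv.1, mul_nonneg hr hv.2.1, by
      nlinarith [mul_nonneg hr hv.2.2]⟩
  · exact ⟨mul_nonneg hr hv.1, mul_le_mul_of_nonneg_left hv.2 hr⟩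
  · exact ⟨mul_nonpos_of_nonneg_of_nonpos hr hv.1, mul_nonneg hr hv.2.1, by
      nlinarith [mul_nonneg hr (neg_nonneg.2 hv.2.2)]⟩
  · exact ⟨mul_nonneg hr hv.1, mul_le_mul_of_nonneg_left hv.2 hr⟩

/-- The integral multiple of the matrix of a letter. -/
def modelLetter : Fin 2 × Bool → Matrix (Fin 2) (Fin 2) ℝ
  | (0, true) => !![β ^ 2 + 1, α ^ 2; β ^ 2, α ^ 2]
  | (1, true) => !![β ^ 2, α ^ 2; β ^ 2, α ^ 2 + 1]
  | (0, false) => !![α ^ 2, -α ^ 2; -β ^ 2, β ^ 2 + 1]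
  | (1, false) => !![α ^ 2 + 1, -α ^ 2; -β ^ 2, β ^ 2]

theorem modelRep_letter (hα : α ≠ 0) (hβ : β ≠ 0) (l : Fin 2 × Bool) :
    (modelRep α β hα hβ (FreeGroup.mk [l])).1 = (![α, β] l.1)⁻¹ • modelLetter α β l := by
  obtain ⟨i, b⟩ := l
  have hinv : (FreeGroup.mk [(i, false)] : Pi1) = (FreeGroup.of i)⁻¹ := rfl
  have hof : (FreeGroup.mk [(i, true)] : Pi1) = FreeGroup.of i := rfl
  cases b
  · rw [hinv, map_inv, Matrix.SpecialLinearGroup.coe_inv, Matrix.adjugate_fin_two]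
    ext j k
    fin_cases i <;> fin_cases j <;> fin_cases k <;>
      simp [modelRep, modelA, modelB, modelLetter]
  · rw [hof]
    fin_cases i <;> simp [modelRep, modelA, modelB, modelLetter]

/-- The sign with which a letter maps the cone of another letter into its own cone. -/
def modelSign (l c : Fin 2 × Bool) : ℝ :=
  if (l = (0, true) ∧ c = (1, false)) ∨ (l = (1, false) ∧ c = (0, true)) then -1 else 1

theorem modelSign_eq (l c : Fin 2 × Bool) : modelSign l c = 1 ∨ modelSign l c = -1 := by
  unfold modelSign
  split_ifs <;> simp

/-- The cone edges are the ideal vertices of a quadrilateral whose sides the generators pair: each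
letter carries the edges of the cone of its inverse to the edges of its own cone, up to scalars. -/
theorem modelLetter_mulVec_mem (l c : Fin 2 × Bool) (h : l.1 = c.1 → l.2 = c.2) (v : Fin 2 → ℝ)
    (hv : v ∈ modelCone α β c) :
    modelSign l c • (modelLetter α β l *ᵥ v) ∈ modelCone α β l := by
  rw [modelSign]
  have hP := sq_nonneg α
  have hQ := sq_nonneg β
  obtain ⟨i, b⟩ := l
  obtain ⟨j, b'⟩ := c
  fin_cases i <;> fin_cases j <;> cases b <;> cases b' <;>
    simp only [modelCone, Set.mem_ofPred_eq] at hv <;> simp at h <;>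
    simp [modelCone, modelLetter, dotProduct, Fin.sum_univ_two] <;>
    generalize α ^ 2 = P at * <;> generalize β ^ 2 = Q at * <;>
    generalize v 0 = X at * <;> generalize v 1 = Y at *
  all_goals
    first
    | obtain ⟨h1, h2, h3⟩ := hv
      refine ⟨?_, ?_, ?_⟩ <;>
        nlinarith [mul_nonneg hP h2, mul_nonneg hQ h2, mul_nonneg hP (neg_nonneg.2 h1),
          mul_nonneg hQ (neg_nonneg.2 h1)]
    | obtain ⟨h1, h2, h3⟩ := hv
      refine ⟨?_, ?_⟩ <;>
        nlinarith [mul_nonneg hP h2, mul_nonneg hQ h2, mul_nonneg hP (neg_nonneg.2 h1),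
          mul_nonneg hQ (neg_nonneg.2 h1)]
    | obtain ⟨h1, h2⟩ := hv
      refine ⟨?_, ?_⟩ <;>
        nlinarith [mul_nonneg hP h1, mul_nonneg hQ h1, mul_nonneg hP (sub_nonneg.2 h2),
          mul_nonneg hQ (sub_nonneg.2 h2)]
    | obtain ⟨h1, h2⟩ := hv
      refine ⟨?_, ?_, ?_⟩ <;>
        nlinarith [mul_nonneg hP h1, mul_nonneg hQ h1, mul_nonneg hP (sub_nonneg.2 h2),
          mul_nonneg hQ (sub_nonneg.2 h2)]

theorem exists_sign_modelRep_mem (hα : α ≠ 0) (hβ : β ≠ 0) (l c : Fin 2 × Bool)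
    (h : l.1 = c.1 → l.2 = c.2) : ∃ s : ℝ, (s = 1 ∨ s = -1) ∧ ∀ v ∈ modelCone α β c,
      s • ((modelRep α β hα hβ (FreeGroup.mk [l])).1 *ᵥ v) ∈ modelCone α β l := by
  have hs := modelSign_eq l c
  have hs' := modelLetter_mulVec_mem α β l c h
  generalize modelSign l c = s at hs hs'
  have hne : ![α, β] l.1 ≠ 0 := by
    obtain ⟨i, b⟩ := l
    fin_cases i
    · exact hα
    · exact hβ
  rw [modelRep_letter]
  rcases lt_or_gt_of_ne hne with hlt | hgt
  · refine ⟨-s, by rcases hs with rfl | rfl <;> simp, fun v hv => ?_⟩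
    have := smul_mem_modelCone α β (inv_nonneg.2 (neg_nonneg.2 hlt.le)) (hs' v hv)
    rw [Matrix.smul_mulVec, smul_comm, neg_smul, smul_neg, ← neg_smul, ← inv_neg]
    exact this
  · refine ⟨s, hs, fun v hv => ?_⟩
    have := smul_mem_modelCone α β (inv_nonneg.2 hgt.le) (hs' v hv)
    rw [Matrix.smul_mulVec, smul_comm]
    exact this

/-- The commutator trace bound for a matrix that maps the complement of the cone of `B⁻¹` into the
cone of `B`. -/
theorem trace_commutator_modelA_le (hα : α ≠ 0) (H : SL(2, ℝ)) (s : ℝ) (hs : s = 1 ∨ s = -1)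
    (h₁ : s • (H.1 *ᵥ ![1, 0]) ∈ modelCone α β (1, true))
    (h₂ : s • (H.1 *ᵥ ![0, 1]) ∈ modelCone α β (1, true))
    (h₃ : s • (H.1 *ᵥ ![-α ^ 2, β ^ 2]) ∈ modelCone α β (1, true)) :
    (modelA α β hα * H * (modelA α β hα)⁻¹ * H⁻¹).1.trace ≤ -2 := by
  have hP : 0 < α ^ 2 := by positivity
  have hQ := sq_nonneg β
  -- `M` preserves the cone of `a`: up to signs, `H⁻¹` sends it into the cone of `b⁻¹`, then `a⁻¹`
  -- into that of `a⁻¹`, `H` into that of `b`, and `a` back. The minus sign absorbs the signs.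
  set M := -(modelA α β hα * H * (modelA α β hα)⁻¹ * H⁻¹) with hM
  suffices h : 2 ≤ M.1.trace by
    rw [hM, Matrix.SpecialLinearGroup.coe_neg, Matrix.trace_neg] at h
    linarith
  have hA : (modelA α β hα).1 = α⁻¹ • !![β ^ 2 + 1, α ^ 2; β ^ 2, α ^ 2] := rfl
  have hs2 : s ^ 2 = 1 := by rcases hs with rfl | rfl <;> norm_num
  simp only [modelCone, Set.mem_ofPred_eq, Pi.smul_apply, smul_eq_mul, Matrix.mulVec, dotProduct,
    Fin.sum_univ_two, Matrix.cons_val_zero, Matrix.cons_val_one, mul_one, mul_zero, add_zero,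
    zero_add] at h₁ h₂ h₃
  have key : M.1 = -((α ^ 2)⁻¹ • (!![β ^ 2 + 1, α ^ 2; β ^ 2, α ^ 2] *
      !![s * H.1 0 0, s * H.1 0 1; s * H.1 1 0, s * H.1 1 1] *
      !![α ^ 2, -α ^ 2; -β ^ 2, β ^ 2 + 1] *
      !![s * H.1 1 1, -(s * H.1 0 1); -(s * H.1 1 0), s * H.1 0 0])) := by
    rw [hM, Matrix.SpecialLinearGroup.coe_neg]
    simp only [Matrix.SpecialLinearGroup.coe_mul, Matrix.SpecialLinearGroup.coe_inv,
      Matrix.adjugate_fin_two, hA]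
    have e1 : !![s * H.1 0 0, s * H.1 0 1; s * H.1 1 0, s * H.1 1 1] = s • H.1 := by
      ext i j; fin_cases i <;> fin_cases j <;> simp
    have e2 : !![s * H.1 1 1, -(s * H.1 0 1); -(s * H.1 1 0), s * H.1 0 0] =
        s • !![H.1 1 1, -H.1 0 1; -H.1 1 0, H.1 0 0] := by
      ext i j; fin_cases i <;> fin_cases j <;> simp
    have e3 : !![(α⁻¹ • !![β ^ 2 + 1, α ^ 2; β ^ 2, α ^ 2]) 1 1,
          -(α⁻¹ • !![β ^ 2 + 1, α ^ 2; β ^ 2, α ^ 2]) 0 1;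
          -(α⁻¹ • !![β ^ 2 + 1, α ^ 2; β ^ 2, α ^ 2]) 1 0,
          (α⁻¹ • !![β ^ 2 + 1, α ^ 2; β ^ 2, α ^ 2]) 0 0] =
        α⁻¹ • !![α ^ 2, -α ^ 2; -β ^ 2, β ^ 2 + 1] := by
      ext i j; fin_cases i <;> fin_cases j <;> simp
    rw [e1, e2, e3]
    simp only [smul_mul_assoc, mul_smul_comm, smul_smul]
    rw [← sq s, hs2, mul_one, sq α, mul_inv]
  have h₃' : 0 ≤ s * H.1 0 1 * β ^ 2 - s * H.1 0 0 * α ^ 2 ∧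
      s * H.1 0 1 * β ^ 2 - s * H.1 0 0 * α ^ 2 ≤ s * H.1 1 1 * β ^ 2 - s * H.1 1 0 * α ^ 2 := by
    constructor <;> linarith [h₃.1, h₃.2]
  clear h₃ hA hM
  clear_value M
  generalize s * H.1 0 0 = a at *
  generalize s * H.1 0 1 = b at *
  generalize s * H.1 1 0 = c at *
  generalize s * H.1 1 1 = d at *
  generalize α ^ 2 = P at *
  generalize β ^ 2 = Q at *
  -- Up to scaling, `(X, Y)` and `(X', Y')` are the images of the edges `(1, 0)` and `(1, 1)` before
  -- the last factor `a` is applied.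
  generalize hX : (c + d) * (b * Q - a * P) + c * b = X
  generalize hY : (c + d) * (d * Q - c * P) + c * d = Y
  generalize hX' : (c - a + (d - b)) * (b * Q - a * P) + (c - a) * b = X'
  generalize hY' : (c - a + (d - b)) * (d * Q - c * P) + (c - a) * d = Y'
  have hc : 0 ≤ c := h₁.1.trans h₁.2
  have hd : 0 ≤ d := h₂.1.trans h₂.2
  have m00 : M.1 0 0 = ((Q + 1) * X + P * Y) / P := by
    rw [key, ← hX, ← hY]
    simp
    field_simp
    ring
  have m10 : M.1 1 0 = (Q * X + P * Y) / P := by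
    rw [key, ← hX, ← hY]
    simp
    field_simp
    ring
  have m01 : M.1 0 0 + M.1 0 1 = ((Q + 1) * X' + P * Y') / P := by
    rw [key, ← hX', ← hY']
    simp
    field_simp
    ring
  have m11 : M.1 1 0 + M.1 1 1 = (Q * X' + P * Y') / P := by
    rw [key, ← hX', ← hY']
    simp
    field_simp
    ring
  have h₃'' := h₃'.1.trans h₃'.2
  have hX0 : 0 ≤ X := by
    rw [← hX]
    exact add_nonneg (mul_nonneg (add_nonneg hc hd) h₃'.1) (mul_nonneg hc h₂.1)
  have hY0 : 0 ≤ Y := by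
    rw [← hY]
    exact add_nonneg (mul_nonneg (add_nonneg hc hd) h₃'') (mul_nonneg hc hd)
  have hca : 0 ≤ c - a := sub_nonneg.2 h₁.2
  have hdb : 0 ≤ d - b := sub_nonneg.2 h₂.2
  have hX0' : 0 ≤ X' := by
    rw [← hX']
    exact add_nonneg (mul_nonneg (add_nonneg hca hdb) h₃'.1) (mul_nonneg hca h₂.1)
  have hY0' : 0 ≤ Y' := by
    rw [← hY']
    exact add_nonneg (mul_nonneg (add_nonneg hca hdb) h₃'') (mul_nonneg hca hd)
  apply two_le_trace_of_mem_cone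
  · rw [m10]
    positivity
  · rw [m10, m00]
    gcongr
    linarith
  · rw [m11]
    positivity
  · rw [m11, m01]
    gcongr
    linarith

/-- For a reduced word `h` of length at least two that begins and ends with `b`, the trace of the
commutator of `a` and `h` is at most `-2`. -/
theorem trace_commutator_modelRep_le (hα : α ≠ 0) (hβ : β ≠ 0) (L : List (Fin 2 × Bool))
    (hL : FreeGroup.IsReduced ((1, true) :: (L ++ [((1 : Fin 2), true)]))) (h : Pi1)
    (hh : h = FreeGroup.mk ((1, true) :: (L ++ [(1, true)]))) :
    (modelRep α β hα hβ (genA * h * genA⁻¹ * h⁻¹)).1.trace ≤ -2 := by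
  obtain ⟨s, hs, hs'⟩ := exists_sign_smul_mem_cone (modelRep α β hα hβ) (modelCone α β)
    (fun _ _ => 0) (fun l c hlc => by
      obtain ⟨s, hs, hs'⟩ := exists_sign_modelRep_mem α β hα hβ l c hlc
      exact ⟨s, hs, fun v hv => ⟨hs' v hv, le_rfl⟩⟩) L (1, true) (1, true) hL
  -- The letter `b` needs one common sign for all three cones; the commutator bound requires the
  -- same sign at its three test vectors.
  obtain ⟨r, hr, hr'⟩ : ∃ r : ℝ, (r = 1 ∨ r = -1) ∧ ∀ c : Fin 2 × Bool, c ≠ (1, false) →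
      ∀ v ∈ modelCone α β c,
      r • ((modelRep α β hα hβ genB).1 *ᵥ v) ∈ modelCone α β (1, true) := by
    refine ⟨SignType.sign β, ?_, fun c hc v hv => ?_⟩
    · rcases lt_or_gt_of_ne hβ with h | h <;> simp [h]
    have e : (SignType.sign β : ℝ) • ((modelRep α β hα hβ genB).1 *ᵥ v) =
        |β|⁻¹ • (modelLetter α β (1, true) *ᵥ v) := by
      have e1 : (modelRep α β hα hβ genB).1 = β⁻¹ • modelLetter α β (1, true) :=
        modelRep_letter α β hα hβ (1, true)
      rw [e1, Matrix.smul_mulVec, smul_smul]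
      rcases lt_or_gt_of_ne hβ with h | h
      · simp [h, abs_of_neg h]
      · simp [h, abs_of_pos h]
    rw [e]
    apply smul_mem_modelCone α β (by positivity)
    have h1 := modelLetter_mulVec_mem α β (1, true) c (by
      obtain ⟨i, b⟩ := c
      cases b
      · fin_cases i
        · simp
        · exact absurd rfl hc
      · simp) v hv
    rwa [modelSign, if_neg (by simp), one_smul] at h1
  have hmem : ∀ c : Fin 2 × Bool, c ≠ (1, false) → ∀ v ∈ modelCone α β c,
      (s * r) • ((modelRep α β hα hβ h).1 *ᵥ v) ∈ modelCone α β (1, true) := by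
    intro c hc v hv
    have e : h = FreeGroup.mk ((1, true) :: L) * genB := by
      rw [hh, genB, FreeGroup.of, FreeGroup.mul_mk]; rfl
    rw [e, map_mul, Matrix.SpecialLinearGroup.coe_mul, ← Matrix.mulVec_mulVec, mul_smul,
      ← Matrix.mulVec_smul]
    exact (hs' _ (hr' c hc v hv)).1
  simp only [map_mul, map_inv]
  have hA : modelRep α β hα hβ genA = modelA α β hα := by simp [modelRep, genA]
  rw [hA]
  apply trace_commutator_modelA_le α β hα _ (s * r)
  · rcases hs with rfl | rfl <;> rcases hr with rfl | rfl <;> simp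
  · exact hmem (0, true) (by simp) _ (by simp [modelCone])
  · exact hmem (1, true) (by simp) _ (by simp [modelCone])
  · exact hmem (0, false) (by simp) _ (by
      simp only [modelCone, Set.mem_ofPred_eq, Matrix.cons_val]
      exact ⟨by nlinarith [sq_nonneg α], sq_nonneg β, by nlinarith⟩)

end PingPong

/-! ### Trace bounds for words that cross `a`. -/

section CrossingWords

/-- A completed square: if the commutator of `A` and `B` has trace at most `-2` then `B` translates
at least as far as in the orthogonal case. -/
theorem trace_sq_ge_of_trace_commutator_le (A B : SL(2, ℝ)) (hA : 4 < A.1.trace ^ 2)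
    (h : (A * B * A⁻¹ * B⁻¹).1.trace ≤ -2) :
    4 * A.1.trace ^ 2 / (A.1.trace ^ 2 - 4) ≤ B.1.trace ^ 2 := by
  rw [trace_commutator] at h
  rw [div_le_iff₀ (by linarith)]
  nlinarith [sq_nonneg ((A.1 * B.1).trace - A.1.trace * B.1.trace / 2)]

/-- For a reduced word `h` that begins and ends with `b`, the trace of the commutator of `a` and `h`
is at most `-2`. -/
theorem trace_commutator_le (σ : Pi1 →* SL(2, ℝ))
    (hσ : (σ (genA * genB * genA⁻¹ * genB⁻¹)).1.trace = -2) (hA : (σ genA).1.trace ≠ 0)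
    (L : List (Fin 2 × Bool))
    (hL : FreeGroup.IsReduced ((1, true) :: (L ++ [((1 : Fin 2), true)]))) (h : Pi1)
    (hh : h = FreeGroup.mk ((1, true) :: (L ++ [(1, true)]))) :
    (σ (genA * h * genA⁻¹ * h⁻¹)).1.trace ≤ -2 := by
  simp only [map_mul, map_inv] at hσ
  rw [trace_commutator] at hσ
  set x := (σ genA).1.trace with hx
  set y := (σ genB).1.trace with hy
  set z := ((σ genA).1 * (σ genB).1).trace with hz
  have hm : x ^ 2 + y ^ 2 + z ^ 2 = x * y * z := by linarith
  have hpos : 0 < x ^ 2 := by positivity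
  have hzz : z * (x * y - z) = x ^ 2 + y ^ 2 := by linarith
  have hz' : x * y - z ≠ 0 := by
    intro h0
    rw [h0] at hzz
    nlinarith [sq_nonneg y]
  have hy0 : y ≠ 0 := by
    intro h0
    rw [h0] at hm
    nlinarith [sq_nonneg z]
  -- This is the trace of `A B⁻¹`. The triple `(x, y, w)` solves the same equation, and dividing by
  -- `w` gives the parameters of the model.
  set w := x * y - z with hw
  have hα : y / w ≠ 0 := div_ne_zero hy0 hz'
  have hβ : x / w ≠ 0 := div_ne_zero hA hz'
  have hm' : x ^ 2 + y ^ 2 + w ^ 2 = x * y * w := by rw [hw]; linarith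
  have hz'' : z = x * y - w := by rw [hw]; ring
  rw [trace_eq_of_trace_eq σ (modelRep (y / w) (x / w) hα hβ)]
  · exact trace_commutator_modelRep_le _ _ hα hβ L hL h hh
  · rw [← hx]
    simp [modelRep, modelA, genA, Matrix.trace_fin_two]
    field_simp
    linarith
  · rw [← hy]
    simp [modelRep, modelB, genB, Matrix.trace_fin_two]
    field_simp
    linarith
  · rw [← hz, hz'']
    simp [modelRep, modelA, modelB, genA, genB, Matrix.trace_fin_two]
    field_simp
    linear_combination -(x ^ 2 + y ^ 2 + x * y * w) * hm'

end CrossingWords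

/-! ### Cyclic words and conjugacy. -/

section CyclicWords

variable {α : Type*}

/-- Repeating the first letter at the end turns the seam of the cyclic word into an ordinary
adjacency, so a failure anywhere can be rotated to the front. For a one-letter word the only
adjacency is of the letter with itself, which `hR` rules out as a failure. -/
theorem exists_isRotated_of_not_isChain (R : α → α → Prop) (l : α) (W : List α) (hR : W = [] → R l l)
    (h : ¬ List.IsChain R (l :: (W ++ [l]))) :
    ∃ c d Q, ¬ R c d ∧ (l :: W).IsRotated (c :: d :: Q) := by
  have key : ∀ V : List α, ¬ List.IsChain R V → ∃ P c d Q, V = P ++ c :: d :: Q ∧ ¬ R c d := by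
    intro V
    induction V with
    | nil => exact fun h => absurd List.isChain_nil h
    | cons c V ih =>
      intro h
      cases V with
      | nil => exact absurd (List.isChain_singleton c) h
      | cons d V =>
        by_cases hcd : R c d
        · rw [List.isChain_cons_cons] at h
          obtain ⟨P, c', d', Q, e, hn⟩ := ih fun h' => h ⟨hcd, h'⟩
          exact ⟨c :: P, c', d', Q, by rw [e]; rfl, hn⟩
        · exact ⟨[], c, d, V, rfl, hcd⟩
  obtain ⟨P, c, d, Q, e, hn⟩ := key _ h
  refine ⟨c, d, ?_⟩
  rcases List.eq_nil_or_concat Q with rfl | ⟨Q', q, rfl⟩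
  · have e' : (l :: W) ++ [l] = (P ++ [c]) ++ [d] := by simpa using e
    obtain ⟨e1, e2⟩ := List.append_inj' e' rfl
    cases P with
    | nil =>
      simp only [List.nil_append, List.cons.injEq] at e1 e2
      exact absurd (by rw [← e1.1, ← e2.1]; exact hR e1.2) hn
    | cons p P =>
      simp only [List.cons_append, List.cons.injEq] at e1 e2
      refine ⟨P, hn, ?_⟩
      rw [e1.2, e2.1.symm]
      exact List.isRotated_append (l := l :: P) (l' := [c])
  · have e' : (l :: W) ++ [l] = (P ++ c :: d :: Q') ++ [q] := by simpa using e
    obtain ⟨e1, e2⟩ := List.append_inj' e' rfl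
    refine ⟨Q' ++ P, hn, ?_⟩
    rw [e1]
    exact List.isRotated_append (l := P) (l' := c :: d :: Q')

/-- The square of a rotation of `W` is a subword of `W W W`. -/
theorem isReduced_append_self_of_isRotated {W V : List (α × Bool)}
    (hW : FreeGroup.IsCyclicallyReduced W) (h : W.IsRotated V) : FreeGroup.IsReduced (V ++ V) := by
  obtain ⟨n, rfl⟩ := h
  have h3 := (hW.flatten_replicate 3).isReduced
  refine h3.infix ⟨W.take (n % W.length), W.drop (n % W.length), ?_⟩
  rw [List.rotate_eq_drop_append_take_mod]
  have := List.take_append_drop (n % W.length) W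
  set P := W.take (n % W.length)
  set Q := W.drop (n % W.length)
  rw [← this]
  simp [List.replicate]

theorem trace_eq_of_isRotated {R : Type*} [CommRing R] (σ : FreeGroup α →* SL(2, R))
    {W V : List (α × Bool)} (h : W.IsRotated V) :
    (σ (FreeGroup.mk V)).1.trace = (σ (FreeGroup.mk W)).1.trace := by
  obtain ⟨n, rfl⟩ := h
  rw [List.rotate_eq_drop_append_take_mod]
  have := List.take_append_drop (n % W.length) W
  set P := W.take (n % W.length)
  set Q := W.drop (n % W.length)
  rw [← this, ← FreeGroup.mul_mk, ← FreeGroup.mul_mk, map_mul, map_mul,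
    Matrix.SpecialLinearGroup.coe_mul, Matrix.SpecialLinearGroup.coe_mul, Matrix.trace_mul_comm]

theorem exists_isCyclicallyReduced_conj [DecidableEq α] (g : FreeGroup α) :
    ∃ W : List (α × Bool), FreeGroup.IsCyclicallyReduced W ∧
      ∃ k : FreeGroup α, g = k * FreeGroup.mk W * k⁻¹ := by
  refine ⟨FreeGroup.reduceCyclically g.toWord,
    FreeGroup.reduceCyclically.isCyclicallyReduced FreeGroup.isReduced_toWord,
    FreeGroup.mk (FreeGroup.reduceCyclically.conjugator g.toWord), ?_⟩
  rw [FreeGroup.inv_mk, FreeGroup.mul_mk, FreeGroup.mul_mk,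
    FreeGroup.reduceCyclically.conj_conjugator_reduceCyclically, FreeGroup.mk_toWord]

theorem trace_conj {R G : Type*} [CommRing R] [Group G] (σ : G →* SL(2, R)) (k g : G) :
    (σ (k * g * k⁻¹)).1.trace = (σ g).1.trace := by
  rw [map_mul, Matrix.SpecialLinearGroup.coe_mul, Matrix.trace_mul_comm,
    ← Matrix.SpecialLinearGroup.coe_mul, ← map_mul]
  group

end CyclicWords

/-! ### Traces of powers. -/

section Powers

variable {R : Type*} [CommRing R]

theorem trace_inv (g : SL(2, R)) : (g⁻¹).1.trace = g.1.trace := by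
  rw [coe_inv_eq, Matrix.trace_sub, Matrix.trace_smul, Matrix.trace_one]
  simp; ring

theorem trace_pow_add_two (g : SL(2, R)) (n : ℕ) :
    (g ^ (n + 2)).1.trace = g.1.trace * (g ^ (n + 1)).1.trace - (g ^ n).1.trace := by
  have h : (g ^ (n + 2)).1 = g.1.trace • (g ^ (n + 1)).1 - (g ^ n).1 := by
    have h1 : (g ^ (n + 2)).1 = (g ^ n).1 * (g.1 * g.1) := by
      rw [pow_add, pow_two]; rfl
    have h2 : (g ^ (n + 1)).1 = (g ^ n).1 * g.1 := by rw [pow_succ]; rfl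
    rw [h1, mul_self_eq, mul_sub, mul_smul_comm, mul_one, h2]
  rw [h, Matrix.trace_sub, Matrix.trace_smul, smul_eq_mul]

theorem trace_pow_of_trace_eq_neg_two (g : SL(2, ℝ)) (hg : g.1.trace = -2) (n : ℕ) :
    (g ^ n).1.trace = 2 * (-1) ^ n := by
  induction n using Nat.twoStepInduction with
  | zero => simp
  | one => simp [hg]
  | more n h1 h2 =>
    rw [trace_pow_add_two, h1, h2, hg]
    ring

theorem abs_trace_le_abs_trace_pow (g : SL(2, ℝ)) (hg : 2 ≤ |g.1.trace|) (n : ℕ) :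
    |g.1.trace| ≤ |(g ^ (n + 1)).1.trace| := by
  suffices h : ∀ n, |(g ^ n).1.trace| ≤ |(g ^ (n + 1)).1.trace| by
    induction n with
    | zero => simp
    | succ n ih => exact ih.trans (h (n + 1))
  intro n
  induction n with
  | zero => simpa using hg
  | succ n ih =>
    rw [trace_pow_add_two]
    have h1 : |g.1.trace * (g ^ (n + 1)).1.trace| - |(g ^ n).1.trace| ≤
      |g.1.trace * (g ^ (n + 1)).1.trace - (g ^ n).1.trace| := abs_sub_abs_le_abs_sub _ _
    rw [abs_mul] at h1
    nlinarith [abs_nonneg (g ^ (n + 1)).1.trace]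

end Powers

/-! ### Ping-pong for the pair of pants. -/

section Pants

open Matrix

variable (x : ℝ)

/-- The matrices of the letters in the model of a group of a pair of pants with one cusp and two
boundary components of equal length. -/
def pantsLetter : Fin 2 × Bool → Matrix (Fin 2) (Fin 2) ℝ
  | (0, true) => !![x, -1; 1, 0]
  | (1, true) => !![0, -1; 1, x]
  | (0, false) => !![0, 1; -1, x]
  | (1, false) => !![x, 1; -1, 0]

/-- The images of the generators in the model of a group of a pair of pants. -/
def pantsGenerator (i : Fin 2) : SL(2, ℝ) :=
  ⟨pantsLetter x (i, true), by fin_cases i <;> simp [pantsLetter, Matrix.det_fin_two]⟩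

/-- The model of a group of a pair of pants. -/
noncomputable def pantsRep : Pi1 →* SL(2, ℝ) := FreeGroup.lift (pantsGenerator x)

theorem coe_pantsRep_of (i : Fin 2) :
    (pantsRep x (FreeGroup.of i)).1 = pantsLetter x (i, true) := by
  rw [pantsRep, FreeGroup.lift_apply_of]
  rfl

theorem pantsRep_letter (l : Fin 2 × Bool) :
    (pantsRep x (FreeGroup.mk [l])).1 = pantsLetter x l := by
  obtain ⟨i, b⟩ := l
  have hinv : (FreeGroup.mk [(i, false)] : Pi1) = (FreeGroup.of i)⁻¹ := rfl
  have hof : (FreeGroup.mk [(i, true)] : Pi1) = FreeGroup.of i := rfl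
  cases b
  · rw [hinv, map_inv, Matrix.SpecialLinearGroup.coe_inv, coe_pantsRep_of,
      Matrix.adjugate_fin_two]
    fin_cases i <;> simp [pantsLetter]
  · rw [hof, coe_pantsRep_of]

/-- The index of the dominant coordinate in the cone of a letter. -/
def pantsIndex : Fin 2 × Bool → Fin 2
  | (0, true) => 0
  | (1, true) => 1
  | (0, false) => 1
  | (1, false) => 0

/-- The cones of the letters for the model of a group of a pair of pants. -/
def pantsCone : Fin 2 × Bool → Set (Fin 2 → ℝ)
  | (0, true) => {v | 0 ≤ v 1 ∧ v 1 ≤ v 0}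
  | (1, true) => {v | v 0 ≤ 0 ∧ -v 0 ≤ v 1}
  | (0, false) => {v | 0 ≤ v 0 ∧ v 0 ≤ v 1}
  | (1, false) => {v | v 1 ≤ 0 ∧ -v 1 ≤ v 0}

/-- The sign with which a letter maps the cone of another letter into its own cone. -/
def pantsSign (l c : Fin 2 × Bool) : ℝ :=
  if l.1 = 0 ∧ c.1 = 1 ∧ l.2 = c.2 then -1 else 1

theorem pantsSign_eq (l c : Fin 2 × Bool) : pantsSign l c = 1 ∨ pantsSign l c = -1 := by
  unfold pantsSign
  split_ifs <;> simp

/-- The dominant coordinate never decreases and gains a factor `x` when the exponent changes sign.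
No such gain is available between different generators with equal exponents, whose product is
parabolic. -/
theorem pantsLetter_mulVec_mem (hx : 2 ≤ x) (l c : Fin 2 × Bool) (h : l.1 = c.1 → l.2 = c.2)
    (v : Fin 2 → ℝ) (hv : v ∈ pantsCone c) :
    pantsSign l c • (pantsLetter x l *ᵥ v) ∈ pantsCone l ∧
      v (pantsIndex c) ≤ (pantsSign l c • (pantsLetter x l *ᵥ v)) (pantsIndex l) ∧
      (l.2 ≠ c.2 →
        x * v (pantsIndex c) ≤ (pantsSign l c • (pantsLetter x l *ᵥ v)) (pantsIndex l)) := by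
  rw [pantsSign]
  obtain ⟨i, b⟩ := l
  obtain ⟨j, b'⟩ := c
  fin_cases i <;> fin_cases j <;> cases b <;> cases b' <;>
    simp only [pantsCone, Set.mem_ofPred_eq] at hv <;> simp at h <;>
    simp [pantsCone, pantsLetter, pantsIndex, dotProduct, Fin.sum_univ_two] <;>
    generalize v 0 = X at * <;> generalize v 1 = Y at *
  all_goals
    obtain ⟨h1, h2⟩ := hv
    constructorm* _ ∧ _ <;> nlinarith

/-- Two equal letters that follow a letter of the other type. -/
theorem pantsLetter_twice_mulVec (hx : 2 ≤ x) (l c : Fin 2 × Bool) (h : l.1 ≠ c.1) (h' : l.2 = c.2)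
    (v : Fin 2 → ℝ) (hv : v ∈ pantsCone c) :
    x * v (pantsIndex c) ≤
      (pantsSign l c • (pantsLetter x l *ᵥ (pantsLetter x l *ᵥ v))) (pantsIndex l) := by
  have hx2 : 0 ≤ x * x - 1 := by nlinarith
  rw [pantsSign]
  obtain ⟨i, b⟩ := l
  obtain ⟨j, b'⟩ := c
  fin_cases i <;> fin_cases j <;> cases b <;> cases b' <;>
    simp only [pantsCone, Set.mem_ofPred_eq] at hv <;> simp at h h' <;>
    simp [pantsLetter, pantsIndex, dotProduct, Fin.sum_univ_two] <;>
    generalize v 0 = X at * <;> generalize v 1 = Y at *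
  all_goals
    obtain ⟨h1, h2⟩ := hv
    first | nlinarith [mul_nonneg hx2 h1] | nlinarith [mul_nonneg hx2 (neg_nonneg.2 h1)]

theorem mulVec_mulVec_self (M : SL(2, ℝ)) (v : Fin 2 → ℝ) :
    M.1 *ᵥ (M.1 *ᵥ v) = M.1.trace • (M.1 *ᵥ v) - v := by
  rw [Matrix.mulVec_mulVec, mul_self_eq, Matrix.sub_mulVec, Matrix.one_mulVec, Matrix.smul_mulVec]

/-- A matrix that maps a cone into itself up to sign and expands the dominant coordinate by a factor
`x` has trace at least `x` in absolute value. -/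
theorem le_abs_trace_of_expanding (hx : 0 < x) (l : Fin 2 × Bool) (M : SL(2, ℝ)) (s : ℝ)
    (hs : s = 1 ∨ s = -1)
    (h : ∀ v ∈ pantsCone l, s • (M.1 *ᵥ v) ∈ pantsCone l ∧
      x * v (pantsIndex l) ≤ (s • (M.1 *ᵥ v)) (pantsIndex l)) : x ≤ |M.1.trace| := by
  obtain ⟨v, hv, hv1⟩ : ∃ v ∈ pantsCone l, v (pantsIndex l) = 1 := by
    refine ⟨fun i => if i = pantsIndex l then 1 else 0, ?_, by simp⟩
    obtain ⟨i, b⟩ := l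
    fin_cases i <;> cases b <;> simp [pantsCone, pantsIndex]
  obtain ⟨h1, h2⟩ := h v hv
  -- A second application gives growth by `x` once more. Cayley–Hamilton expresses the second
  -- iterate through the first, with the trace as factor, and the first iterate can be cancelled.
  obtain ⟨-, h3⟩ := h _ h1
  have hs2 : s * s = 1 := by rcases hs with rfl | rfl <;> norm_num
  rw [Matrix.mulVec_smul, smul_smul, hs2, one_smul, mulVec_mulVec_self] at h3
  simp only [Pi.sub_apply, Pi.smul_apply, smul_eq_mul, hv1] at h2 h3
  have hsabs : |s| = 1 := by rcases hs with rfl | rfl <;> norm_num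
  have h4 : M.1.trace * (M.1 *ᵥ v) (pantsIndex l) ≤
      |M.1.trace| * (s * (M.1 *ᵥ v) (pantsIndex l)) := by
    calc M.1.trace * (M.1 *ᵥ v) (pantsIndex l)
        = (s * s) * (M.1.trace * (M.1 *ᵥ v) (pantsIndex l)) := by rw [hs2, one_mul]
      _ = (s * M.1.trace) * (s * (M.1 *ᵥ v) (pantsIndex l)) := by ring
      _ ≤ |M.1.trace| * (s * (M.1 *ᵥ v) (pantsIndex l)) := by
          apply mul_le_mul_of_nonneg_right _ (by linarith)
          calc s * M.1.trace ≤ |s * M.1.trace| := le_abs_self _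
            _ = |M.1.trace| := by rw [abs_mul, hsabs, one_mul]
  have h5 : x * (s * (M.1 *ᵥ v) (pantsIndex l)) ≤ |M.1.trace| * (s * (M.1 *ᵥ v) (pantsIndex l)) := by
    linarith
  exact le_of_mul_le_mul_right h5 (by linarith)

theorem exists_sign_pantsRep (hx : 2 ≤ x) (L : List (Fin 2 × Bool)) (l c : Fin 2 × Bool)
    (hL : FreeGroup.IsReduced (l :: (L ++ [c]))) :
    ∃ s : ℝ, (s = 1 ∨ s = -1) ∧
      ∀ v ∈ pantsCone c, s • ((pantsRep x (FreeGroup.mk (l :: L))).1 *ᵥ v) ∈ pantsCone l ∧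
        v (pantsIndex c) ≤ (s • ((pantsRep x (FreeGroup.mk (l :: L))).1 *ᵥ v)) (pantsIndex l) :=
  exists_sign_smul_mem_cone (pantsRep x) pantsCone (fun l v => v (pantsIndex l))
    (fun l c h => ⟨pantsSign l c, pantsSign_eq l c, fun v hv => by
      rw [pantsRep_letter]
      have := pantsLetter_mulVec_mem x hx l c h v hv
      exact ⟨this.1, this.2.1⟩⟩) L l c hL

theorem coe_pantsRep_cons (l : Fin 2 × Bool) (L : List (Fin 2 × Bool)) :
    (pantsRep x (FreeGroup.mk (l :: L))).1 = pantsLetter x l * (pantsRep x (FreeGroup.mk L)).1 := by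
  rw [show (FreeGroup.mk (l :: L) : Pi1) = FreeGroup.mk [l] * FreeGroup.mk L by
    rw [FreeGroup.mul_mk]; rfl, map_mul, Matrix.SpecialLinearGroup.coe_mul, pantsRep_letter]

/-- The word maps the cone of its first letter into itself; the sign change supplies the factor `x`,
and the remaining letters lose nothing. -/
theorem le_abs_trace_of_sign_change (hx : 2 ≤ x) (l c : Fin 2 × Bool) (Q : List (Fin 2 × Bool))
    (h : l.2 ≠ c.2) (hW : FreeGroup.IsReduced (l :: c :: Q ++ l :: c :: Q)) :
    x ≤ |(pantsRep x (FreeGroup.mk (l :: c :: Q))).1.trace| := by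
  obtain ⟨s, hs, hs'⟩ := exists_sign_pantsRep x hx Q c l (hW.infix ⟨[l], c :: Q, by simp⟩)
  have hlc : l.1 = c.1 → l.2 = c.2 := by
    have := hW
    rw [FreeGroup.IsReduced, List.cons_append, List.cons_append, List.isChain_cons_cons] at this
    exact this.1
  refine le_abs_trace_of_expanding x (by linarith) l _ (pantsSign l c * s) ?_ fun v hv => ?_
  · rcases hs with rfl | rfl <;> rcases pantsSign_eq l c with e | e <;> simp [e]
  · obtain ⟨h1, h2⟩ := hs' v hv
    obtain ⟨h3, -, h4⟩ := pantsLetter_mulVec_mem x hx l c hlc _ h1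
    rw [coe_pantsRep_cons, ← Matrix.mulVec_mulVec, mul_smul, ← Matrix.mulVec_smul]
    refine ⟨h3, le_trans ?_ (h4 h)⟩
    exact mul_le_mul_of_nonneg_left h2 (by linarith)

theorem le_abs_trace_of_repetition (hx : 2 ≤ x) (l c : Fin 2 × Bool) (Q : List (Fin 2 × Bool))
    (h : l.1 ≠ c.1) (h' : l.2 = c.2)
    (hW : FreeGroup.IsReduced (l :: l :: c :: Q ++ l :: l :: c :: Q)) :
    x ≤ |(pantsRep x (FreeGroup.mk (l :: l :: c :: Q))).1.trace| := by
  obtain ⟨s, hs, hs'⟩ := exists_sign_pantsRep x hx Q c l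
    (hW.infix ⟨[l, l], l :: c :: Q, by simp⟩)
  refine le_abs_trace_of_expanding x (by linarith) l _ (pantsSign l c * s) ?_ fun v hv => ?_
  · rcases hs with rfl | rfl <;> rcases pantsSign_eq l c with e | e <;> simp [e]
  · obtain ⟨h1, h2⟩ := hs' v hv
    obtain ⟨h3, -, -⟩ := pantsLetter_mulVec_mem x hx l c (fun e => absurd e h) _ h1
    obtain ⟨h5, -, -⟩ := pantsLetter_mulVec_mem x hx l l (fun _ => rfl) _ h3
    have h6 := pantsLetter_twice_mulVec x hx l c h h' _ h1
    have e : pantsSign l l = 1 := by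
      rw [pantsSign, if_neg]
      rintro ⟨h, h', -⟩
      rw [h] at h'
      exact zero_ne_one h'
    rw [e, one_smul, Matrix.mulVec_smul] at h5
    rw [coe_pantsRep_cons, coe_pantsRep_cons, ← Matrix.mulVec_mulVec, ← Matrix.mulVec_mulVec,
      mul_smul]
    simp only [Matrix.mulVec_smul] at h5 h6
    refine ⟨h5, le_trans ?_ h6⟩
    exact mul_le_mul_of_nonneg_left h2 (by linarith)

theorem trace_pantsRep_letter (l : Fin 2 × Bool) :
    (pantsRep x (FreeGroup.mk [l])).1.trace = x := by
  rw [pantsRep_letter]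
  obtain ⟨i, b⟩ := l
  fin_cases i <;> cases b <;> simp [pantsLetter, Matrix.trace_fin_two]

theorem mk_replicate {α : Type*} (n : ℕ) (l : α × Bool) :
    FreeGroup.mk (List.replicate n l) = FreeGroup.mk [l] ^ n := by
  induction n with
  | zero => rfl
  | succ n ih =>
    rw [pow_succ', ← ih, FreeGroup.mul_mk]
    rfl

/-- A word with letters of one sign that contains a repetition. -/
theorem le_abs_trace_of_square (hx : 2 ≤ x) (W : List (Fin 2 × Bool)) (l : Fin 2 × Bool)
    (Q : List (Fin 2 × Bool)) (hW : FreeGroup.IsCyclicallyReduced W)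
    (hr : W.IsRotated (l :: l :: Q)) (hQ : ∀ c ∈ Q, l.2 = c.2) :
    x ≤ |(pantsRep x (FreeGroup.mk W)).1.trace| := by
  rw [← trace_eq_of_isRotated _ hr]
  have hsplit : (Q = List.replicate Q.length l) ∨
      ∃ k c Q', c ≠ l ∧ Q = List.replicate k l ++ c :: Q' := by
    clear hr hQ
    induction Q with
    | nil => exact Or.inl rfl
    | cons q Q ih =>
      by_cases hq : q = l
      · subst hq
        rcases ih with h | ⟨k, c, Q', hc, h⟩
        · left
          rw [List.length_cons, List.replicate_succ, ← h]
        · exact Or.inr ⟨k + 1, c, Q', hc, by rw [h, List.replicate_succ]; rfl⟩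
      · exact Or.inr ⟨0, q, Q, hq, rfl⟩
  rcases hsplit with h | ⟨k, c, Q', hc, rfl⟩
  · have e : l :: l :: Q = List.replicate (Q.length + 1 + 1) l := by
      rw [List.replicate_succ, List.replicate_succ, ← h]
    rw [e, mk_replicate, map_pow]
    have := abs_trace_le_abs_trace_pow (pantsRep x (FreeGroup.mk [l]))
      (by rw [trace_pantsRep_letter]; exact hx.trans (le_abs_self x)) (Q.length + 1)
    rw [trace_pantsRep_letter] at this
    exact (le_abs_self x).trans this
  · have hc2 : l.2 = c.2 := hQ c (by simp)
    have hc1 : l.1 ≠ c.1 := fun h => hc (Prod.ext h.symm hc2.symm)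
    -- The surplus copies of `l` go to the end, leaving exactly two before a letter of the other
    -- type.
    have hr2 : (l :: l :: (List.replicate k l ++ c :: Q')).IsRotated
        (l :: l :: c :: (Q' ++ List.replicate k l)) := by
      have e : l :: l :: (List.replicate k l ++ c :: Q') =
          List.replicate k l ++ (l :: l :: c :: Q') := by
        have : ∀ k, l :: l :: (List.replicate k l ++ c :: Q') =
          List.replicate (k + 2) l ++ c :: Q' := fun k => rfl
        rw [this, List.replicate_add]
        simp [List.replicate]
      rw [e]
      exact List.isRotated_append
    rw [← trace_eq_of_isRotated _ hr2]
    exact le_abs_trace_of_repetition x hx l c _ hc1 hc2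
      (isReduced_append_self_of_isRotated hW (hr.trans hr2))

/-- The exceptional case of the pants dichotomy: these words are powers of the parabolic boundary
element. -/
theorem mk_eq_pow_of_alternating (l : Fin 2 × Bool) :
    ∀ W : List (Fin 2 × Bool), (∀ c ∈ W, c.2 = l.2) →
      List.IsChain (fun a b => a.1 ≠ b.1) (l :: (W ++ [l])) →
      ∃ n : ℕ, FreeGroup.mk (l :: W) = (FreeGroup.mk [l] * FreeGroup.mk [(l.1 + 1, l.2)]) ^ n
  | [], _, h => by simp at h
  | c :: W, hs, h => by
    rw [List.cons_append, List.isChain_cons_cons] at h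
    have other : ∀ i j : Fin 2, i ≠ j → j = i + 1 := by decide
    have hc : c = (l.1 + 1, l.2) := Prod.ext (other _ _ h.1) (hs c (by simp))
    cases W with
    | nil => exact ⟨1, by rw [pow_one, hc, FreeGroup.mul_mk]; rfl⟩
    | cons d W =>
      have h2 := h.2
      rw [List.cons_append, List.isChain_cons_cons] at h2
      have twice : ∀ i j : Fin 2, i + 1 ≠ j → j = i := by decide
      have hd : d = l := Prod.ext (twice _ _ (by rw [hc] at h2; exact h2.1)) (hs d (by simp))
      subst hd
      obtain ⟨n, hn⟩ := mk_eq_pow_of_alternating d W (fun c hc => hs c (by simp [hc])) h2.2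
      refine ⟨n + 1, ?_⟩
      rw [pow_succ', ← hn, hc, FreeGroup.mul_mk, FreeGroup.mul_mk]
      rfl

theorem trace_pantsRep_pair (l : Fin 2 × Bool) :
    (pantsRep x (FreeGroup.mk [l] * FreeGroup.mk [(l.1 + 1, l.2)])).1.trace = -2 := by
  rw [map_mul, Matrix.SpecialLinearGroup.coe_mul, pantsRep_letter, pantsRep_letter]
  obtain ⟨i, b⟩ := l
  fin_cases i <;> cases b <;> simp [pantsLetter, Matrix.trace_fin_two] <;> norm_num

/-- In the group of a pair of pants the elements that are neither trivial nor peripheral about the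
cusp translate at least as far as the boundary. -/
theorem le_abs_trace_pantsRep (hx : 2 ≤ x) (g : Pi1) :
    |(pantsRep x g).1.trace| = 2 ∨ x ≤ |(pantsRep x g).1.trace| := by
  obtain ⟨W, hW, k, rfl⟩ := exists_isCyclicallyReduced_conj g
  rw [trace_conj]
  cases W with
  | nil =>
    left
    rw [← FreeGroup.one_eq_mk, map_one]
    simp
  | cons l W =>
    by_cases h1 : List.IsChain (fun a b : Fin 2 × Bool => a.2 = b.2) (l :: (W ++ [l]))
    · have hsign : ∀ c ∈ l :: W, l.2 = c.2 := by
        have hch : List.IsChain (fun a b : Fin 2 × Bool => a.2 = b.2) (l :: W) :=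
          h1.infix ⟨[], [l], by simp⟩
        have htr : List.Pairwise (fun a b : Fin 2 × Bool => a.2 = b.2) (l :: W) := by
          have : IsTrans (Fin 2 × Bool) (fun a b => a.2 = b.2) := ⟨fun _ _ _ h h' => h.trans h'⟩
          exact List.isChain_iff_pairwise.1 hch
        rw [List.pairwise_cons] at htr
        intro c hc
        rcases List.mem_cons.1 hc with rfl | hc
        · rfl
        · exact htr.1 c hc
      by_cases h2 : List.IsChain (fun a b : Fin 2 × Bool => a.1 ≠ b.1) (l :: (W ++ [l]))
      · left
        obtain ⟨n, hn⟩ := mk_eq_pow_of_alternating l W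
          (fun c hc => (hsign c (List.mem_cons_of_mem _ hc)).symm) h2
        rw [hn, map_pow, trace_pow_of_trace_eq_neg_two _ (trace_pantsRep_pair x l)]
        simp [abs_mul, abs_pow]
      · right
        by_cases hne : W = []
        · subst hne
          rw [trace_pantsRep_letter]
          exact le_abs_self x
        obtain ⟨c, d, Q, hcd, hr⟩ : ∃ c d Q, ¬ (c : Fin 2 × Bool).1 ≠ d.1 ∧
            (l :: W).IsRotated (c :: d :: Q) :=
          exists_isRotated_of_not_isChain _ l W (fun h => absurd h hne) h2
        have hmem : ∀ e ∈ c :: d :: Q, l.2 = e.2 := fun e he => hsign e (hr.mem_iff.2 he)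
        have hcd' : d = c := Prod.ext (not_not.1 hcd).symm
          ((hmem d (by simp)).symm.trans (hmem c (by simp)))
        subst hcd'
        exact le_abs_trace_of_square x hx _ d Q hW hr fun e he =>
          (hmem d (by simp)).symm.trans (hmem e (by simp [he]))
    · right
      obtain ⟨c, d, Q, hcd, hr⟩ := exists_isRotated_of_not_isChain
        (fun a b : Fin 2 × Bool => a.2 = b.2) l W (fun _ => rfl) h1
      rw [← trace_eq_of_isRotated _ hr]
      exact le_abs_trace_of_sign_change x hx c d Q hcd
        (isReduced_append_self_of_isRotated hW hr)

end Pants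

/-! ### Words that cross `a` and words in the pair of pants. -/

section Dichotomy

/-- The inclusion of the fundamental group of the pair of pants obtained by cutting along `a`. -/
def pantsHom : Pi1 →* Pi1 := FreeGroup.lift ![genA, genB * genA⁻¹ * genB⁻¹]

theorem pantsHom_genA : pantsHom genA = genA := by simp [pantsHom, genA]

theorem pantsHom_genB : pantsHom genB = genB * genA⁻¹ * genB⁻¹ := by simp [pantsHom, genB]

theorem mk_mem_zpowers {A : List (Fin 2 × Bool)} (hA : ∀ c ∈ A, c.1 = 0) :
    FreeGroup.mk A ∈ Subgroup.zpowers genA := by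
  induction A with
  | nil => exact one_mem _
  | cons c A ih =>
    rw [show (FreeGroup.mk (c :: A) : Pi1) = FreeGroup.mk [c] * FreeGroup.mk A by
      rw [FreeGroup.mul_mk]; rfl]
    refine mul_mem ?_ (ih fun d hd => hA d (List.mem_cons_of_mem _ hd))
    obtain ⟨i, b⟩ := c
    obtain rfl : i = 0 := hA _ List.mem_cons_self
    cases b
    · exact inv_mem (Subgroup.mem_zpowers genA)
    · exact Subgroup.mem_zpowers genA

theorem zpowers_le_range_pantsHom : Subgroup.zpowers genA ≤ pantsHom.range := by
  rw [Subgroup.zpowers_le]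
  exact ⟨genA, pantsHom_genA⟩

theorem conj_mem_range_pantsHom {p : Pi1} (hp : p ∈ Subgroup.zpowers genA) :
    genB * p * genB⁻¹ ∈ pantsHom.range := by
  obtain ⟨n, rfl⟩ := Subgroup.mem_zpowers_iff.1 hp
  refine ⟨genB ^ (-n), ?_⟩
  rw [map_zpow, pantsHom_genB, ← MulAut.conj_apply, ← MulAut.conj_apply, ← map_zpow]
  simp

/-- A cyclic word that contains two `b`-letters of equal sign without a `b`-letter in between, read
off starting from the second of them. -/
def IsCrossing (W : List (Fin 2 × Bool)) : Prop :=
  ∃ (ε : Bool) (V A : List (Fin 2 × Bool)), (∀ c ∈ A, c.1 = 0) ∧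
    (V = [(1, ε)] ∨ ∃ V', V = (1, ε) :: (V' ++ [(1, ε)])) ∧ W.IsRotated (V ++ A)

theorem IsCrossing.of_isRotated {W W' : List (Fin 2 × Bool)} (h : W.IsRotated W')
    (hW : IsCrossing W') : IsCrossing W := by
  obtain ⟨ε, V, A, hA, hV, hr⟩ := hW
  exact ⟨ε, V, A, hA, hV, h.trans hr⟩

/-- A scan of the word: `(1, ε)` is the latest `b`-letter, `A` the `a`-letters read since, `M` the
unread rest. While the signs alternate, what precedes is a product of powers of `a` and of
conjugates `b aᵏ b⁻¹`, up to a pending `b`. A final `b` that stays open meets the initial `b`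
cyclically, hence a crossing. -/
theorem isCrossing_or_mem_of_split (W : List (Fin 2 × Bool)) :
    ∀ (M P A : List (Fin 2 × Bool)) (ε : Bool), W = P ++ (1, ε) :: (A ++ M) →
      (∀ c ∈ A, c.1 = 0) → (P ++ [(1, ε)]).head? = some (1, true) →
      (if ε then FreeGroup.mk P else FreeGroup.mk P * genB⁻¹) ∈ pantsHom.range →
      IsCrossing W ∨ FreeGroup.mk W ∈ pantsHom.range := by
  intro M
  induction M with
  | nil =>
    intro P A ε hW hA hhead hmem
    rw [List.append_nil] at hW
    cases ε
    · right
      have e : (FreeGroup.mk W : Pi1) = FreeGroup.mk P * genB⁻¹ * FreeGroup.mk A := by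
        rw [hW, genB, FreeGroup.of, FreeGroup.inv_mk, FreeGroup.mul_mk, FreeGroup.mul_mk]
        simp [FreeGroup.invRev]
      rw [e]
      exact mul_mem (by simpa using hmem) (zpowers_le_range_pantsHom (mk_mem_zpowers hA))
    · left
      cases P with
      | nil => exact ⟨true, [(1, true)], A, hA, Or.inl rfl, by rw [hW]; exact List.IsRotated.refl _⟩
      | cons p P =>
        simp only [List.cons_append, List.head?_cons, Option.some.injEq] at hhead
        refine ⟨true, (1, true) :: (P ++ [(1, true)]), A, hA, Or.inr ⟨P, rfl⟩, ?_⟩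
        rw [hW, hhead]
        simp only [List.cons_append, List.append_assoc, List.nil_append]
        exact List.IsRotated.refl _
  | cons c M ih =>
    intro P A ε hW hA hhead hmem
    obtain ⟨i, b⟩ := c
    by_cases hi : i = 0
    · subst hi
      refine ih P (A ++ [(0, b)]) ε (by simp [hW]) ?_ hhead hmem
      intro c hc
      rcases List.mem_append.1 hc with h | h
      · exact hA c h
      · rw [List.mem_singleton.1 h]
    · obtain rfl : i = 1 := by
        have : ∀ i : Fin 2, i ≠ 0 → i = 1 := by decide
        exact this i hi
      by_cases hb : b = ε
      · subst hb
        left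
        refine ⟨b, (1, b) :: ((M ++ P) ++ [(1, b)]), A, hA, Or.inr ⟨M ++ P, rfl⟩, ?_⟩
        rw [hW]
        have h := List.isRotated_append (l := P ++ (1, b) :: A) (l' := (1, b) :: M)
        simpa using h
      · refine ih (P ++ (1, ε) :: A) [] b (by simp [hW]) (by simp) ?_ ?_
        · cases P with
          | nil => simpa using hhead
          | cons p P => simpa using hhead
        · have hmA := mk_mem_zpowers hA
          have e : (FreeGroup.mk (P ++ (1, ε) :: A) : Pi1) =
              FreeGroup.mk P * FreeGroup.mk [(1, ε)] * FreeGroup.mk A := by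
            rw [FreeGroup.mul_mk, FreeGroup.mul_mk]
            simp
          rw [e]
          cases ε <;> cases b <;> simp only [reduceIte, Bool.false_eq_true] at hb hmem ⊢
          · exact absurd trivial hb
          · exact mul_mem hmem (zpowers_le_range_pantsHom hmA)
          · rw [show FreeGroup.mk P * FreeGroup.mk [(1, true)] * FreeGroup.mk A * genB⁻¹ =
              FreeGroup.mk P * (genB * FreeGroup.mk A * genB⁻¹) by
                simp only [mul_assoc]; rfl]
            exact mul_mem hmem (conj_mem_range_pantsHom hmA)
          · exact absurd trivial hb

theorem forall_or_exists_last (W : List (Fin 2 × Bool)) (hW : ∀ c ∈ W, c ≠ (1, true)) :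
    (∀ c ∈ W, c.1 = 0) ∨ ∃ V A, W = V ++ (1, false) :: A ∧ ∀ c ∈ A, c.1 = 0 := by
  induction W with
  | nil => left; simp
  | cons c W ih =>
    rcases ih fun d hd => hW d (List.mem_cons_of_mem _ hd) with h | ⟨V, A, rfl, hA⟩
    · by_cases hc : c.1 = 0
      · left
        intro d hd
        rcases List.mem_cons.1 hd with rfl | hd
        · exact hc
        · exact h d hd
      · right
        refine ⟨[], W, ?_, h⟩
        obtain ⟨i, b⟩ := c
        have h1 : i = 1 := by
          have : ∀ i : Fin 2, i ≠ 0 → i = 1 := by decide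
          exact this i hc
        subst h1
        cases b
        · rfl
        · exact absurd rfl (hW _ List.mem_cons_self)
    · exact Or.inr ⟨c :: V, A, rfl, hA⟩

/-- A cyclic word either crosses `a` or represents an element of the pair of pants. -/
theorem isCrossing_or_mem (W : List (Fin 2 × Bool)) :
    IsCrossing W ∨ ∃ W', W.IsRotated W' ∧ FreeGroup.mk W' ∈ pantsHom.range := by
  by_cases hb : (1, true) ∈ W
  · obtain ⟨P, Q, rfl⟩ := List.append_of_mem hb
    have hr : (P ++ (1, true) :: Q).IsRotated ((1, true) :: (Q ++ P)) :=
      List.isRotated_append (l := P) (l' := (1, true) :: Q)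
    rcases isCrossing_or_mem_of_split ((1, true) :: (Q ++ P)) (Q ++ P) [] [] true (by simp)
      (by simp) (by simp) (one_mem pantsHom.range) with h | h
    · exact Or.inl (h.of_isRotated hr)
    · exact Or.inr ⟨_, hr, h⟩
  · rcases forall_or_exists_last W (fun c hc e => hb (e ▸ hc)) with h | ⟨V, A, rfl, hA⟩
    · exact Or.inr ⟨W, List.IsRotated.refl _, zpowers_le_range_pantsHom (mk_mem_zpowers h)⟩
    · left
      rcases forall_or_exists_last V
        (fun c hc e => hb (e ▸ List.mem_append_left _ hc)) with h | ⟨V', A', rfl, hA'⟩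
      · refine ⟨false, [(1, false)], A ++ V, ?_, Or.inl rfl, ?_⟩
        · intro c hc
          rcases List.mem_append.1 hc with hc | hc
          · exact hA c hc
          · exact h c hc
        · exact List.isRotated_append (l := V) (l' := (1, false) :: A)
      · refine ⟨false, (1, false) :: ((A ++ V') ++ [(1, false)]), A', hA', Or.inr ⟨_, rfl⟩, ?_⟩
        have h := List.isRotated_append (l := V' ++ (1, false) :: A') (l' := (1, false) :: A)
        simpa using h

end Dichotomy

/-! ### The lower bound for traces of hyperbolic elements. -/

section LowerBound

theorem trace_commutator_inv_right {R : Type*} [CommRing R] (A B : SL(2, R)) :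
    (A * B⁻¹ * A⁻¹ * B).1.trace = (A * B * A⁻¹ * B⁻¹).1.trace := by
  rw [← trace_inv (A * B * A⁻¹ * B⁻¹)]
  have h : (A * B * A⁻¹ * B⁻¹)⁻¹ = B * (A * B⁻¹ * A⁻¹ * B) * B⁻¹ := by group
  rw [h]
  exact (trace_conj (MonoidHom.id SL(2, R)) B _).symm

theorem isReduced_invRev {V : List (Fin 2 × Bool)} (h : FreeGroup.IsReduced V) :
    FreeGroup.IsReduced (FreeGroup.invRev V) := by
  rw [FreeGroup.isReduced_iff_reduce_eq] at h ⊢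
  rw [FreeGroup.reduce_invRev, h]

theorem trace_sq_ge_of_isCrossing (σ : Pi1 →* SL(2, ℝ))
    (hσ : (σ (genA * genB * genA⁻¹ * genB⁻¹)).1.trace = -2) (hA : 4 < (σ genA).1.trace ^ 2)
    (W : List (Fin 2 × Bool)) (hW : FreeGroup.IsCyclicallyReduced W) (hc : IsCrossing W) :
    4 * (σ genA).1.trace ^ 2 / ((σ genA).1.trace ^ 2 - 4) ≤
      (σ (FreeGroup.mk W)).1.trace ^ 2 := by
  obtain ⟨ε, V, P, hP, hV, hr⟩ := hc
  rw [← trace_eq_of_isRotated _ hr, ← FreeGroup.mul_mk]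
  have hA0 : (σ genA).1.trace ≠ 0 := by
    intro h
    rw [h] at hA
    norm_num at hA
  have hred : FreeGroup.IsReduced V :=
    (isReduced_append_self_of_isRotated hW hr).infix ⟨[], P ++ (V ++ P), by simp⟩
  apply trace_sq_ge_of_trace_commutator_le _ _ hA
  have hcomm : Commute (FreeGroup.mk P) genA := by
    obtain ⟨n, hn⟩ := Subgroup.mem_zpowers_iff.1 (mk_mem_zpowers hP)
    rw [← hn]
    exact (Commute.refl genA).zpow_left n
  -- The trailing power of `a` commutes with `a` and drops out of the commutator.
  have e : genA * (FreeGroup.mk V * FreeGroup.mk P) * genA⁻¹ * (FreeGroup.mk V * FreeGroup.mk P)⁻¹ =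
      genA * FreeGroup.mk V * genA⁻¹ * (FreeGroup.mk V)⁻¹ := by
    have h1 : FreeGroup.mk P * genA⁻¹ = genA⁻¹ * FreeGroup.mk P := hcomm.inv_right.eq
    rw [mul_inv_rev, ← mul_assoc genA, mul_assoc _ _ genA⁻¹, h1]
    group
  rw [← map_inv, ← map_inv, ← map_mul, ← map_mul, ← map_mul, e]
  cases ε
  · have key : (σ (genA * (FreeGroup.mk V)⁻¹ * genA⁻¹ * ((FreeGroup.mk V)⁻¹)⁻¹)).1.trace ≤ -2 := by
      rcases hV with rfl | ⟨V', rfl⟩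
      · exact hσ.le
      · refine trace_commutator_le σ hσ hA0 (FreeGroup.invRev V') ?_ _ ?_
        · have := isReduced_invRev hred
          simpa [FreeGroup.invRev] using this
        · rw [FreeGroup.inv_mk]
          simp [FreeGroup.invRev]
    simp only [map_mul, map_inv, inv_inv] at key ⊢
    rwa [trace_commutator_inv_right] at key
  · rcases hV with rfl | ⟨V', rfl⟩
    · exact hσ.le
    · exact trace_commutator_le σ hσ hA0 V' hred _ rfl

theorem eq_or_eq_neg_of_generators (σ τ : Pi1 →* SL(2, ℝ))
    (h : ∀ i, τ (FreeGroup.of i) = -σ (FreeGroup.of i)) (g : Pi1) : τ g = σ g ∨ τ g = -σ g := by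
  induction g using FreeGroup.induction_on with
  | C1 => left; rw [map_one, map_one]
  | of i => exact Or.inr (h i)
  | inv_of i hi =>
    right
    rw [map_inv, map_inv, h i]
    ext a b
    simp
  | mul g g' h1 h2 =>
    rw [map_mul, map_mul]
    rcases h1 with h1 | h1 <;> rcases h2 with h2 | h2 <;> rw [h1, h2]
    · exact Or.inl rfl
    · exact Or.inr (mul_neg _ _)
    · exact Or.inr (neg_mul _ _)
    · exact Or.inl (neg_mul_neg _ _)

theorem abs_trace_ge_of_pants (σ : Pi1 →* SL(2, ℝ)) (x : ℝ) (hx : 2 ≤ |x|)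
    (ha : (σ genA).1.trace = x) (hb : (σ genB).1.trace = x)
    (hab : ((σ genA).1 * (σ genB).1).trace = -2) (g : Pi1) :
    |(σ g).1.trace| = 2 ∨ |x| ≤ |(σ g).1.trace| := by
  have hmodel : ∀ y, (pantsRep y genA).1.trace = y ∧ (pantsRep y genB).1.trace = y ∧
      ((pantsRep y genA).1 * (pantsRep y genB).1).trace = -2 := fun y =>
    ⟨trace_pantsRep_letter y (0, true), trace_pantsRep_letter y (1, true), by
      have := trace_pantsRep_pair y (0, true)
      rw [map_mul, Matrix.SpecialLinearGroup.coe_mul] at this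
      exact this⟩
  rcases le_or_gt 0 x with h0 | h0
  · rw [abs_of_nonneg h0] at hx ⊢
    obtain ⟨h1, h2, h3⟩ := hmodel x
    rw [trace_eq_of_trace_eq σ (pantsRep x) (by rw [ha, h1]) (by rw [hb, h2]) (by rw [hab, h3])]
    exact le_abs_trace_pantsRep x hx g
  · rw [abs_of_neg h0] at hx ⊢
    obtain ⟨h1, h2, h3⟩ := hmodel (-x)
    -- Negating both generators makes `x` positive and leaves the trace of their product unchanged.
    let τ : Pi1 →* SL(2, ℝ) := FreeGroup.lift fun i => -σ (FreeGroup.of i)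
    have hτ : ∀ i, τ (FreeGroup.of i) = -σ (FreeGroup.of i) := fun i => FreeGroup.lift_apply_of
    have hτA : (τ genA).1 = -(σ genA).1 := by
      rw [genA, hτ, Matrix.SpecialLinearGroup.coe_neg]
    have hτB : (τ genB).1 = -(σ genB).1 := by
      rw [genB, hτ, Matrix.SpecialLinearGroup.coe_neg]
    have habs : |(σ g).1.trace| = |(τ g).1.trace| := by
      rcases eq_or_eq_neg_of_generators σ τ hτ g with h | h
      · rw [h]
      · rw [h, Matrix.SpecialLinearGroup.coe_neg, Matrix.trace_neg, abs_neg]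
    rw [habs, trace_eq_of_trace_eq τ (pantsRep (-x))]
    · exact le_abs_trace_pantsRep (-x) hx g
    · rw [hτA, Matrix.trace_neg, ha, h1]
    · rw [hτB, Matrix.trace_neg, hb, h2]
    · rw [hτA, hτB, neg_mul_neg, hab, h3]

/-- On a punctured torus every hyperbolic element translates at least as far as the simple closed
geodesic `a`, or at least as far as a curve that meets `a` once orthogonally. -/
theorem trace_sq_lower_bound (σ : Pi1 →* SL(2, ℝ))
    (hσ : (σ (genA * genB * genA⁻¹ * genB⁻¹)).1.trace = -2) (hA : 4 < (σ genA).1.trace ^ 2)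
    (g : Pi1) (hg : 4 < (σ g).1.trace ^ 2) :
    (σ genA).1.trace ^ 2 ≤ (σ g).1.trace ^ 2 ∨
      4 * (σ genA).1.trace ^ 2 / ((σ genA).1.trace ^ 2 - 4) ≤ (σ g).1.trace ^ 2 := by
  obtain ⟨W, hW, k, rfl⟩ := exists_isCyclicallyReduced_conj g
  rw [trace_conj] at hg ⊢
  rcases isCrossing_or_mem W with hc | ⟨W', hr, p, hp⟩
  · exact Or.inr (trace_sq_ge_of_isCrossing σ hσ hA W hW hc)
  · left
    rw [← trace_eq_of_isRotated _ hr, ← hp] at hg ⊢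
    have h2 : 2 ≤ |(σ genA).1.trace| := by
      rw [← abs_two (α := ℝ)]
      exact sq_le_sq.1 (by norm_num; linarith)
    have ha : ((σ.comp pantsHom) genA).1.trace = (σ genA).1.trace := by
      rw [MonoidHom.comp_apply, pantsHom_genA]
    have hb : ((σ.comp pantsHom) genB).1.trace = (σ genA).1.trace := by
      rw [MonoidHom.comp_apply, pantsHom_genB, trace_conj, map_inv, trace_inv]
    have hab : (((σ.comp pantsHom) genA).1 * ((σ.comp pantsHom) genB).1).trace = -2 := by
      rw [← hσ, ← Matrix.SpecialLinearGroup.coe_mul, ← map_mul, MonoidHom.comp_apply, map_mul,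
        pantsHom_genA, pantsHom_genB]
      simp only [mul_assoc]
    rcases abs_trace_ge_of_pants (σ.comp pantsHom) _ h2 ha hb hab p with h | h
    · rw [MonoidHom.comp_apply] at h
      rw [← sq_abs, h] at hg
      norm_num at hg
    · exact sq_le_sq.2 h

end LowerBound

/-! ### Lengths in terms of traces. -/

section Lengths

/-- The translation length of a hyperbolic isometry as a function of the square of the trace. -/
noncomputable def lengthOfTraceSq (s : ℝ) : ℝ := 2 * Real.arsinh (√(s - 4) / 2)

theorem lengthOfTraceSq_mono {s t : ℝ} (h : s ≤ t) : lengthOfTraceSq s ≤ lengthOfTraceSq t := by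
  unfold lengthOfTraceSq
  have := Real.arsinh_le_arsinh.2
    (div_le_div_of_nonneg_right (Real.sqrt_le_sqrt (sub_le_sub_right h 4)) zero_le_two)
  linarith

theorem translationLength_eq (A : SL(2, ℝ)) (hA : 4 < A.1.trace ^ 2) :
    translationLength A = lengthOfTraceSq (A.1.trace ^ 2) :=
  translationLength_of_isHyperbolic A ((isHyperbolic_iff A).2 hA)

theorem sinh_half_lengthOfTraceSq (s : ℝ) :
    Real.sinh (lengthOfTraceSq s / 2) = √(s - 4) / 2 := by
  rw [lengthOfTraceSq, mul_div_cancel_left₀ _ two_ne_zero, Real.sinh_arsinh]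

theorem cosh_half_lengthOfTraceSq (x : ℝ) (hx : 4 < x ^ 2) :
    Real.cosh (lengthOfTraceSq (x ^ 2) / 2) = |x| / 2 := by
  rw [lengthOfTraceSq, mul_div_cancel_left₀ _ two_ne_zero, Real.cosh_arsinh, div_pow,
    Real.sq_sqrt (by linarith), show 1 + (x ^ 2 - 4) / 2 ^ 2 = (x / 2) ^ 2 by ring,
    Real.sqrt_sq_eq_abs, abs_div, abs_two]

theorem lengthOfTraceSq_pos {s : ℝ} (hs : 4 < s) : 0 < lengthOfTraceSq s := by
  have h : 0 < √(s - 4) := Real.sqrt_pos.2 (by linarith)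
  have := Real.arsinh_pos_iff.2 (show 0 < √(s - 4) / 2 by positivity)
  unfold lengthOfTraceSq
  linarith

/-- Both sides solve `sinh (L/2) sinh (R/2) = 1` for `R`. -/
theorem injRadius_lengthOfTraceSq {s : ℝ} (hs : 4 < s) :
    injRadius (lengthOfTraceSq s) = lengthOfTraceSq (4 * s / (s - 4)) := by
  have hr : 0 < √(s - 4) := Real.sqrt_pos.2 (by linarith)
  have hr2 : √(s - 4) ^ 2 = s - 4 := Real.sq_sqrt (by linarith)
  have hsinh := sinh_half_lengthOfTraceSq s
  have hE : 1 < Real.exp (lengthOfTraceSq s / 2) := by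
    rw [Real.one_lt_exp_iff]
    linarith [lengthOfTraceSq_pos hs]
  rw [Real.sinh_eq, Real.exp_neg] at hsinh
  rw [injRadius, lengthOfTraceSq.eq_def (4 * s / (s - 4))]
  congr 1
  set E := Real.exp (lengthOfTraceSq s / 2)
  have hE0 : 0 < E := by linarith
  have hE1 : 0 < E - 1 := by linarith
  apply Real.sinh_injective
  rw [Real.sinh_arsinh, Real.sinh_log (by positivity)]
  have h1 : √(4 * s / (s - 4) - 4) = 4 / √(s - 4) := by
    rw [Real.sqrt_eq_iff_mul_self_eq_of_pos (by positivity)]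
    rw [div_mul_div_comm, ← sq √(s - 4), hr2]
    have : s - 4 ≠ 0 := by linarith
    field_simp
    ring
  rw [h1]
  have h2 : √(s - 4) = (E ^ 2 - 1) / E := by
    field_simp at hsinh ⊢
    linarith
  have h3 : E ^ 2 - 1 ≠ 0 := by nlinarith
  rw [h2]
  field_simp
  ring

end Lengths

/-! ### Translations along the axis and the Dehn twist. -/

section Twist

variable (A : SL(2, ℝ))

theorem coe_axisTranslation (hA : A.1.IsHyperbolic) (t : ℝ) :
    (axisTranslation A t).1 = axisTranslationMatrix A t := by
  have h : axisTranslation A t = ⟨axisTranslationMatrix A t, det_axisTranslationMatrix A hA t⟩ :=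
    dif_pos hA
  rw [h]

theorem commute_axisTranslation (t : ℝ) : Commute (axisTranslation A t) A := by
  by_cases hA : A.1.IsHyperbolic
  · apply Subtype.ext
    rw [Matrix.SpecialLinearGroup.coe_mul, Matrix.SpecialLinearGroup.coe_mul,
      coe_axisTranslation A hA, axisTranslationMatrix]
    simp only [add_mul, mul_add, smul_mul_assoc, mul_smul_comm, one_mul, mul_one, sub_mul, mul_sub]
  · have h : axisTranslation A t = 1 := dif_neg hA
    rw [h]
    exact Commute.one_left A

/-- Up to the sign of its trace, `A` is itself the translation along its axis by its own length; the
rest is the addition formulas for `cosh` and `sinh`. -/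
theorem axisTranslationMatrix_add_length (hA : 4 < A.1.trace ^ 2) (t : ℝ) :
    axisTranslationMatrix A (t + lengthOfTraceSq (A.1.trace ^ 2)) =
      (SignType.sign A.1.trace : ℝ) • (axisTranslationMatrix A t * A.1) := by
  have hne : A.1.trace ≠ 0 := by
    intro h
    rw [h] at hA
    norm_num at hA
  have hr : √(A.1.trace ^ 2 / 4 - 1) = √(A.1.trace ^ 2 - 4) / 2 := by
    rw [Real.sqrt_eq_iff_mul_self_eq (by linarith) (by positivity), div_mul_div_comm,
      Real.mul_self_sqrt (by linarith)]
    ring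
  have hpos : 0 < √(A.1.trace ^ 2 - 4) / 2 := by
    have : 0 < √(A.1.trace ^ 2 - 4) := Real.sqrt_pos.2 (by linarith)
    positivity
  have hsq : (√(A.1.trace ^ 2 - 4) / 2) ^ 2 = A.1.trace ^ 2 / 4 - 1 := by
    rw [div_pow, Real.sq_sqrt (by linarith)]
    ring
  have hs2 : (SignType.sign A.1.trace : ℝ) ^ 2 = 1 := by
    rcases lt_or_gt_of_ne hne with h | h
    · simp [h]
    · simp [h]
  have habs : |A.1.trace| = (SignType.sign A.1.trace : ℝ) * A.1.trace := by
    rw [sign_mul_self]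
  simp only [axisTranslationMatrix]
  rw [hr, add_div, Real.cosh_add, Real.sinh_add, cosh_half_lengthOfTraceSq _ hA,
    sinh_half_lengthOfTraceSq, habs]
  simp only [add_mul, smul_mul_assoc, one_mul, sub_mul, mul_self_eq A]
  generalize (SignType.sign A.1.trace : ℝ) = s at *
  generalize √(A.1.trace ^ 2 - 4) / 2 = r at *
  generalize A.1.trace = x at *
  generalize Real.cosh (t / 2) = c
  generalize Real.sinh (t / 2) = h
  have hx : x ^ 2 = 4 * r ^ 2 + 4 := by linarith
  ext i j
  simp only [Matrix.add_apply, Matrix.smul_apply, Matrix.sub_apply, smul_eq_mul]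
  generalize A.1 i j = a
  generalize (1 : Matrix (Fin 2) (Fin 2) ℝ) i j = e
  field_simp
  linear_combination h * e * (4 - x ^ 2) * hs2 - h * e * hx

theorem axisTranslation_add_nat_mul (hA : A.1.IsHyperbolic) (t : ℝ) (k : ℕ) :
    axisTranslation A (t + k * translationLength A) = axisTranslation A t * A ^ k ∨
      axisTranslation A (t + k * translationLength A) = -(axisTranslation A t * A ^ k) := by
  have hA' := (isHyperbolic_iff A).1 hA
  have hstep : ∀ u, axisTranslation A (u + translationLength A) = axisTranslation A u * A ∨
      axisTranslation A (u + translationLength A) = -(axisTranslation A u * A) := by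
    intro u
    have h := axisTranslationMatrix_add_length A hA' u
    rw [← translationLength_eq A hA', ← coe_axisTranslation A hA, ← coe_axisTranslation A hA] at h
    have hne : A.1.trace ≠ 0 := by
      intro h
      rw [h] at hA'
      norm_num at hA'
    rcases lt_or_gt_of_ne hne with hlt | hgt
    · right
      apply Subtype.ext
      rw [h, sign_neg hlt, Matrix.SpecialLinearGroup.coe_neg, Matrix.SpecialLinearGroup.coe_mul]
      simp
    · left
      apply Subtype.ext
      rw [h, sign_pos hgt, Matrix.SpecialLinearGroup.coe_mul]
      simp
  induction k with
  | zero => simp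
  | succ k ih =>
    have e : t + ((k + 1 : ℕ) : ℝ) * translationLength A =
      t + k * translationLength A + translationLength A := by push_cast; ring
    rw [e, pow_succ, ← mul_assoc]
    rcases hstep (t + k * translationLength A) with h | h <;> rcases ih with h' | h' <;>
      rw [h, h'] <;> simp

/-- For some twist parameter the curve that crosses `A` once does so orthogonally. -/
theorem exists_trace_mul_axisTranslation_sq (B : SL(2, ℝ)) (hA : A.1.IsHyperbolic)
    (h : (A * B * A⁻¹ * B⁻¹).1.trace = -2) :
    ∃ t : ℝ, (B * axisTranslation A t).1.trace ^ 2 =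
      4 * A.1.trace ^ 2 / (A.1.trace ^ 2 - 4) := by
  have hA' := (isHyperbolic_iff A).1 hA
  have hne : A.1.trace ≠ 0 := by
    intro h
    rw [h] at hA'
    norm_num at hA'
  rw [trace_commutator] at h
  set r := √(A.1.trace ^ 2 / 4 - 1) with hr
  have hr0 : 0 < r := Real.sqrt_pos.2 (by linarith)
  have hr2 : r ^ 2 = A.1.trace ^ 2 / 4 - 1 := Real.sq_sqrt (by linarith)
  have hs2 : (SignType.sign A.1.trace : ℝ) ^ 2 = 1 := by
    rcases lt_or_gt_of_ne hne with h | h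
    · simp [h]
    · simp [h]
  set s := (SignType.sign A.1.trace : ℝ)
  set n := s / r * ((A.1 * B.1).trace - A.1.trace * B.1.trace / 2) with hn
  have htr : ∀ t, (B * axisTranslation A t).1.trace =
      Real.cosh (t / 2) * B.1.trace + Real.sinh (t / 2) * n := by
    intro t
    rw [Matrix.SpecialLinearGroup.coe_mul, coe_axisTranslation A hA, axisTranslationMatrix,
      mul_add, Matrix.trace_add, mul_smul_comm, mul_smul_comm, mul_one, mul_sub, mul_smul_comm,
      mul_one, Matrix.trace_smul, Matrix.trace_smul, Matrix.trace_sub, Matrix.trace_smul,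
      Matrix.trace_mul_comm B.1 A.1, hn]
    simp only [smul_eq_mul]
    ring
  have hS : 4 * A.1.trace ^ 2 / (A.1.trace ^ 2 - 4) = A.1.trace ^ 2 / r ^ 2 := by
    rw [hr2, div_eq_div_iff (by linarith) (by linarith)]
    ring
  -- The commutator condition enters here; positivity of this product makes the minimum over `t`
  -- attained.
  have hyn : (B.1.trace - n) * (B.1.trace + n) = A.1.trace ^ 2 / r ^ 2 := by
    rw [hn, eq_div_iff (by positivity)]
    generalize (A.1 * B.1).trace = z at *
    generalize B.1.trace = y at *
    generalize A.1.trace = x at *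
    have e : (y - s / r * (z - x * y / 2)) * (y + s / r * (z - x * y / 2)) * r ^ 2 =
        y ^ 2 * r ^ 2 - s ^ 2 * (z - x * y / 2) ^ 2 := by
      field_simp
      ring
    rw [e]
    linear_combination y ^ 2 * hr2 - (z - x * y / 2) ^ 2 * hs2 - h
  have hpos : 0 < (B.1.trace - n) * (B.1.trace + n) := by
    rw [hyn]
    positivity
  have hq : 0 < (B.1.trace - n) / (B.1.trace + n) := by
    rw [div_pos_iff]
    exact mul_pos_iff.1 hpos
  have hne' : B.1.trace + n ≠ 0 := right_ne_zero_of_mul hpos.ne'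
  -- The trace is half the sum of `e^(t/2) (y + n)` and `e^(-t/2) (y - n)`; this `t` makes the two
  -- terms equal.
  refine ⟨Real.log ((B.1.trace - n) / (B.1.trace + n)), ?_⟩
  rw [htr, hS, ← hyn, Real.cosh_eq, Real.sinh_eq, Real.exp_neg]
  have hE : Real.exp (Real.log ((B.1.trace - n) / (B.1.trace + n)) / 2) ^ 2 =
      (B.1.trace - n) / (B.1.trace + n) := by
    rw [← Real.exp_nat_mul, Nat.cast_ofNat, mul_div_cancel₀ _ two_ne_zero, Real.exp_log hq]
  have hE0 := Real.exp_pos (Real.log ((B.1.trace - n) / (B.1.trace + n)) / 2)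
  generalize Real.exp (Real.log ((B.1.trace - n) / (B.1.trace + n)) / 2) = E at *
  rw [eq_div_iff hne'] at hE
  generalize B.1.trace = y at *
  have e : (E + E⁻¹) / 2 * y + (E - E⁻¹) / 2 * n = E * (y + n) := by
    field_simp
    linear_combination -hE
  rw [e]
  linear_combination (y + n) * hE

end Twist

/-! ### The systole along the twist. -/

section Systole

variable {X : Pi1 →* SL(2, ℝ)} {θ : Pi1 ≃* Pi1}

/-- The holonomy of the twisted structure in terms of the basis adapted to the twist curve. -/
noncomputable def twistRep (X : Pi1 →* SL(2, ℝ)) (θ : Pi1 ≃* Pi1) (t : ℝ) : Pi1 →* SL(2, ℝ) :=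
  FreeGroup.lift ![X (θ genA), X (θ genB) * axisTranslation (X (θ genA)) t]

theorem twistRep_genA (t : ℝ) : twistRep X θ t genA = X (θ genA) := by
  simp [twistRep, genA]

theorem twistRep_genB (t : ℝ) :
    twistRep X θ t genB = X (θ genB) * axisTranslation (X (θ genA)) t := by
  simp [twistRep, genB]

theorem earthquake_apply (t : ℝ) (g : Pi1) :
    earthquake X θ t g = twistRep X θ t (θ.symm g) := rfl

theorem trace_commutator_twistRep (hX : IsTeichmullerPoint X) (t : ℝ) :
    (twistRep X θ t (genA * genB * genA⁻¹ * genB⁻¹)).1.trace = -2 := by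
  rw [← hX.trace_basis θ]
  simp only [map_mul, map_inv, twistRep_genA, twistRep_genB]
  have h := (commute_axisTranslation (X (θ genA)) t).inv_right.eq
  generalize axisTranslation (X (θ genA)) t = T at *
  have e : X (θ genA) * (X (θ genB) * T) * (X (θ genA))⁻¹ * (X (θ genB) * T)⁻¹ =
      X (θ genA) * X (θ genB) * (X (θ genA))⁻¹ * (X (θ genB))⁻¹ := by
    rw [mul_inv_rev, ← mul_assoc (X (θ genA)), mul_assoc _ _ (X (θ genA))⁻¹, h]
    group
  rw [e]

theorem bddBelow_lengths (ρ : Pi1 →* SL(2, ℝ)) :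
    BddBelow {l : ℝ | ∃ g : Pi1, (ρ g).1.IsHyperbolic ∧ l = length ρ g} := by
  refine ⟨0, ?_⟩
  rintro _ ⟨g, -, rfl⟩
  exact Real.iInf_nonneg fun z => dist_nonneg

theorem systole_le (ρ : Pi1 →* SL(2, ℝ)) (g : Pi1) (hg : (ρ g).1.IsHyperbolic) :
    systole ρ ≤ length ρ g :=
  csInf_le (bddBelow_lengths ρ) ⟨g, hg, rfl⟩

theorem systole_earthquake_le_length (hX : IsTeichmullerPoint X) (t : ℝ) :
    systole (earthquake X θ t) ≤ length X (θ genA) := by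
  have h : earthquake X θ t (θ genA) = X (θ genA) := by
    rw [earthquake_apply, MulEquiv.symm_apply_apply, twistRep_genA]
  have h1 := systole_le (earthquake X θ t) (θ genA) (by rw [h]; exact hX.isHyperbolic_basis θ)
  rwa [length, h] at h1

theorem le_systole_earthquake (hX : IsTeichmullerPoint X) (t : ℝ) :
    min (length X (θ genA)) (injRadius (length X (θ genA))) ≤ systole (earthquake X θ t) := by
  have hA := hX.isHyperbolic_basis θ
  have hA' := (isHyperbolic_iff _).1 hA
  refine le_csInf ⟨_, θ genA, ?_, rfl⟩ ?_
  · rw [earthquake_apply, MulEquiv.symm_apply_apply, twistRep_genA]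
    exact hA
  · rintro _ ⟨g, hg, rfl⟩
    have hg' := (isHyperbolic_iff _).1 hg
    rw [length, length, translationLength_eq _ hA', translationLength_eq _ hg',
      injRadius_lengthOfTraceSq hA']
    rw [earthquake_apply] at hg' ⊢
    rcases trace_sq_lower_bound (twistRep X θ t) (trace_commutator_twistRep hX t)
      (by rw [twistRep_genA]; exact hA') _ hg' with h | h <;> rw [twistRep_genA] at h
    · exact (min_le_left _ _).trans (lengthOfTraceSq_mono h)
    · exact (min_le_right _ _).trans (lengthOfTraceSq_mono h)

theorem exists_systole_earthquake_le (hX : IsTeichmullerPoint X) (a : ℝ) :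
    ∃ t, a ≤ t ∧ systole (earthquake X θ t) ≤ injRadius (length X (θ genA)) := by
  have hA := hX.isHyperbolic_basis θ
  have hA' := (isHyperbolic_iff _).1 hA
  have hcomm := hX.trace_basis θ
  simp only [map_mul, map_inv] at hcomm
  obtain ⟨u, hu⟩ := exists_trace_mul_axisTranslation_sq (X (θ genA)) (X (θ genB)) hA hcomm
  have hL : 0 < translationLength (X (θ genA)) := by
    rw [translationLength_eq _ hA']
    exact lengthOfTraceSq_pos hA'
  set k := ⌈(a - u) / translationLength (X (θ genA))⌉₊
  refine ⟨u + k * translationLength (X (θ genA)), ?_, ?_⟩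
  · have := Nat.le_ceil ((a - u) / translationLength (X (θ genA)))
    rw [div_le_iff₀ hL] at this
    linarith
  · set t := u + k * translationLength (X (θ genA))
    -- The factor `a⁻ᵏ` undoes the `k` Dehn twists, so this curve has the trace that `b` has at time
    -- `u`, up to sign.
    have htr : (earthquake X θ t (θ (genB * (genA ^ k)⁻¹))).1.trace ^ 2 =
        4 * (X (θ genA)).1.trace ^ 2 / ((X (θ genA)).1.trace ^ 2 - 4) := by
      rw [earthquake_apply, MulEquiv.symm_apply_apply, map_mul, map_inv, map_pow, twistRep_genA,
        twistRep_genB, ← hu]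
      rcases axisTranslation_add_nat_mul (X (θ genA)) hA u k with h | h
      · rw [h, mul_assoc, mul_assoc, mul_inv_cancel, mul_one]
      · rw [h, mul_neg, neg_mul, mul_assoc, mul_assoc, mul_inv_cancel, mul_one,
          Matrix.SpecialLinearGroup.coe_neg, Matrix.trace_neg, neg_sq]
    have hgt : 4 < (earthquake X θ t (θ (genB * (genA ^ k)⁻¹))).1.trace ^ 2 := by
      rw [htr, lt_div_iff₀ (by linarith)]
      linarith
    refine (systole_le _ _ ((isHyperbolic_iff _).2 hgt)).trans ?_
    rw [length, length, translationLength_eq _ hgt, htr, translationLength_eq _ hA',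
      injRadius_lengthOfTraceSq hA']

end Systole

end PuncturedTorus

theorem mainTheorem6 (X : PuncturedTorus.Pi1 →* Matrix.SpecialLinearGroup (Fin 2) ℝ)
    (hX : PuncturedTorus.IsTeichmullerPoint X)
    (γ : PuncturedTorus.Pi1) (hγ : PuncturedTorus.IsSimpleClosedGeodesic γ) :
    ∀ θ : PuncturedTorus.Pi1 ≃* PuncturedTorus.Pi1, θ PuncturedTorus.genA = γ →
      Filter.liminf (fun t : ℝ => PuncturedTorus.systole (PuncturedTorus.earthquake X θ t))
          Filter.atTop =
        min (PuncturedTorus.length X γ)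
          (PuncturedTorus.injRadius (PuncturedTorus.length X γ)) := by
  rintro θ rfl
  have hlow := PuncturedTorus.le_systole_earthquake (θ := θ) hX
  have hup := PuncturedTorus.systole_earthquake_le_length (θ := θ) hX
  apply le_antisymm
  · refine Filter.liminf_le_of_frequently_le (Filter.frequently_atTop.2 fun a => ?_)
      (Filter.isBoundedUnder_of ⟨_, hlow⟩)
    obtain ⟨t, hat, ht⟩ := PuncturedTorus.exists_systole_earthquake_le (θ := θ) hX a
    exact ⟨t, hat, le_min (hup t) ht⟩
  · exact Filter.le_liminf_of_le
      (Filter.isBoundedUnder_of ⟨_, hup⟩ : Filter.IsBoundedUnder (· ≤ ·) _ _).isCoboundedUnder_ge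
      (Filter.Eventually.of_forall hlow)
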